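/- **Theorem.** Let $R$ be a commutative ring. Let $\mathcal P$ be the free $R$-module on the isomorphism classes of finite posets that have a minimal element $\widehat 0$ and a maximal element $\widehat 1$. It is a Hopf algebra whose product is the Cartesian product of posets, whose unit is the one-point poset, whose coproduct is $\Delta(P)=\sum_{x\in P}[\widehat 0,x]\otimes[x,\widehat 1]$, and whose counit is $\varepsilon(P)=1$ if $P$ has one element and $\varepsilon(P)=0$ otherwise. Let $S$ be its antipode. For positive integers $n$ and $d$ let $\mathrm{NC}^d_n$ be the set of noncrossing partitions $\pi$ of $[n]=\{1,\dots,n\}$ such that all the blocks of $\pi$ and of its Kreweras dual $\pi'$ have cardinality congruent to $1$ modulo $d$, ordered by refinement. (Two different sets $B,C\subseteq[n]$ cross if there are $i<j<k<\ell$ with $i,k$ in one of them and $j,\ell$ in the other; a family of sets is noncrossing if no two different members cross. To obtain $\pi'$, place the points $1,1',2,2',\dots,n,n'$ in this order on a circle; $i'$ and $j'$ are in the same block of $\pi'$ if they lie in the same region of the complement of the convex hulls of the blocks of $\pi$.) If $n\equiv 1 \bmod d$, then $\mathrm{NC}^d_n$ has a minimal and a maximal element, so that it is an element of $\mathcal P$.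 A hypertree on $[n]$ is a set $T$ of subsets of $[n]$, called edges, each of cardinality at least $2$, such that any two different vertices $x,y\in[n]$ are connected by a sequence of edges $E_1,\dots,E_k\in T$ with $x\in E_1$, $y\in E_k$ and $E_i\cap E_{i+1}\neq\emptyset$ for $1\le i<k$, and such that $\sum_{E\in T}(|E|-1)=n-1$. Let $n$ and $d$ be positive integers such that $n\equiv 1\bmod d$. Then $$S(\mathrm{NC}^d_n)=\sum_T(-1)^{|T|}\cdot\prod_{E\in T}\mathrm{NC}^d_{|E|},$$ where $T$ ranges over all noncrossing hypertrees on $[n]$ all of whose edges $E$ satisfy $|E|\equiv 1\bmod d$, and $|T|$ is the number of edges of $T$. -/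

import Mathlib

/-! ## The Hopf algebra of finite bounded posets -/

noncomputable section

open scoped TensorProduct
open WithConv

/-- A finite poset that has a minimal element `⊥` and a maximal element `⊤`. -/
structure FinBddPoset : Type 1 where
  carrier : Type
  [partialOrder : PartialOrder carrier]
  [boundedOrder : BoundedOrder carrier]
  [finite : Finite carrier]

attribute [instance] FinBddPoset.partialOrder FinBddPoset.boundedOrder FinBddPoset.finite

/-- Isomorphism of posets. -/
instance FinBddPoset.isoSetoid : Setoid FinBddPoset where
  r P Q := Nonempty (P.carrier ≃o Q.carrier)
  iseqv :=
    { refl := fun _ => ⟨OrderIso.refl _⟩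
      symm := fun ⟨e⟩ => ⟨e.symm⟩
      trans := fun ⟨e⟩ ⟨f⟩ => ⟨e.trans f⟩ }

/-- Isomorphism classes of finite posets with `⊥` and `⊤`. -/
def PosetClass : Type 1 := Quotient FinBddPoset.isoSetoid

namespace PosetClass

/-- The isomorphism class of `α`. -/
def of (α : Type) [PartialOrder α] [BoundedOrder α] [Finite α] : PosetClass :=
  Quotient.mk FinBddPoset.isoSetoid ⟨α⟩

section

variable {α β : Type} [PartialOrder α] [BoundedOrder α] [Finite α]
  [PartialOrder β] [BoundedOrder β] [Finite β]

theorem of_eq_of_iso (e : α ≃o β) : of α = of β := Quotient.sound ⟨e⟩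

theorem of_eq_iff : of α = of β ↔ Nonempty (α ≃o β) := Quotient.eq

end

theorem ind {p : PosetClass → Prop}
    (h : ∀ (α : Type) [PartialOrder α] [BoundedOrder α] [Finite α], p (of α)) (c : PosetClass) :
    p c :=
  Quotient.inductionOn c fun P => h P.carrier

/-- An isomorphism of Cartesian products. -/
def prodIso {α β γ δ : Type} [PartialOrder α] [PartialOrder β] [PartialOrder γ] [PartialOrder δ]
    (e : α ≃o γ) (f : β ≃o δ) : α × β ≃o γ × δ where
  toEquiv := Equiv.prodCongr e.toEquiv f.toEquiv
  map_rel_iff' := by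
    rintro ⟨a, b⟩ ⟨a', b'⟩
    simp [Prod.le_def]

/-- The product is the Cartesian product of posets, and the unit is the one-point poset. -/
instance : CommMonoid PosetClass where
  mul := Quotient.map₂ (fun P Q => ⟨P.carrier × Q.carrier⟩)
    (fun _ _ ⟨e⟩ _ _ ⟨f⟩ => ⟨prodIso e f⟩)
  one := of Unit
  mul_assoc a b c := by
    induction a using PosetClass.ind with | _ α
    induction b using PosetClass.ind with | _ β
    induction c using PosetClass.ind with | _ γ
    exact of_eq_of_iso (OrderIso.prodAssoc α β γ)
  mul_comm a b := by
    induction a using PosetClass.ind with | _ α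
    induction b using PosetClass.ind with | _ β
    exact of_eq_of_iso OrderIso.prodComm
  one_mul a := by
    induction a using PosetClass.ind with | _ α
    exact of_eq_of_iso
      { toEquiv := Equiv.punitProd α
        map_rel_iff' := by rintro ⟨a, b⟩ ⟨a', b'⟩; simp [Prod.le_def] }
  mul_one a := by
    induction a using PosetClass.ind with | _ α
    exact of_eq_of_iso
      { toEquiv := Equiv.prodPUnit α
        map_rel_iff' := by rintro ⟨a, b⟩ ⟨a', b'⟩; simp [Prod.le_def] }

/-- The number of elements of a poset. -/
def card : PosetClass → ℕ :=
  Quotient.lift (fun P : FinBddPoset => Nat.card P.carrier)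
    (fun _ _ ⟨e⟩ => Nat.card_congr e.toEquiv)

theorem of_mul_of (α β : Type) [PartialOrder α] [BoundedOrder α] [Finite α]
    [PartialOrder β] [BoundedOrder β] [Finite β] : of α * of β = of (α × β) := rfl

theorem one_def : (1 : PosetClass) = of Unit := rfl

end PosetClass

/-- The free `R`-module on the isomorphism classes of finite posets with `⊥` and `⊤`. -/
def PosetHopf (R : Type*) [CommRing R] : Type _ := MonoidAlgebra R PosetClass

namespace PosetHopf

variable (R : Type*) [CommRing R]

instance : CommRing (PosetHopf R) := inferInstanceAs (CommRing (MonoidAlgebra R PosetClass))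

instance : Algebra R (PosetHopf R) := inferInstanceAs (Algebra R (MonoidAlgebra R PosetClass))

/-- The basis element of an isomorphism class, as a monoid homomorphism. -/
def ofClass : PosetClass →* PosetHopf R := MonoidAlgebra.of R PosetClass

/-- The basis element given by the isomorphism class of `α`. -/
def of (α : Type) [PartialOrder α] [BoundedOrder α] [Finite α] : PosetHopf R :=
  ofClass R (PosetClass.of α)

/-- The isomorphism classes form a basis. -/
def basis : Module.Basis PosetClass R (PosetHopf R) := MonoidAlgebra.basis PosetClass R

/-- A multiplicative function on isomorphism classes extends to an algebra homomorphism. -/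
def liftHom {A : Type*} [Semiring A] [Algebra R A] (f : PosetClass →* A) : PosetHopf R →ₐ[R] A :=
  MonoidAlgebra.lift R A PosetClass f

variable {R}

section

variable (α β : Type) [PartialOrder α] [BoundedOrder α] [Finite α]
  [PartialOrder β] [BoundedOrder β] [Finite β]

theorem of_eq_of_iso {α β : Type} [PartialOrder α] [BoundedOrder α] [Finite α]
    [PartialOrder β] [BoundedOrder β] [Finite β] (e : α ≃o β) : of R α = of R β := by
  rw [of, of, PosetClass.of_eq_of_iso e]

theorem of_mul_of : of R α * of R β = of R (α × β) := by
  rw [of, of, of, ← map_mul, PosetClass.of_mul_of]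

theorem of_eq_one [Subsingleton α] : of R α = 1 := by
  have : PosetClass.of α = 1 := PosetClass.of_eq_of_iso
    { toFun := fun _ => ()
      invFun := fun _ => ⊥
      left_inv := fun _ => Subsingleton.elim _ _
      right_inv := fun _ => rfl
      map_rel_iff' := by intro a b; simp [Subsingleton.elim a b] }
  rw [of, this, map_one]

end

theorem basis_apply (c : PosetClass) : basis R c = ofClass R c := rfl

theorem liftHom_of {A : Type*} [Semiring A] [Algebra R A] (f : PosetClass →* A)
    (α : Type) [PartialOrder α] [BoundedOrder α] [Finite α] :
    liftHom R f (of R α) = f (PosetClass.of α) :=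
  MonoidAlgebra.lift_of f _

theorem algHom_ext {A : Type*} [Semiring A] [Algebra R A] {f g : PosetHopf R →ₐ[R] A}
    (h : ∀ (α : Type) [PartialOrder α] [BoundedOrder α] [Finite α],
      f (of R α) = g (of R α)) : f = g := by
  refine MonoidAlgebra.algHom_ext (fun c => ?_) (by ext)
  induction c using PosetClass.ind with | _ α
  exact h α

theorem linearMap_ext {A : Type*} [AddCommMonoid A] [Module R A] {f g : PosetHopf R →ₗ[R] A}
    (h : ∀ (α : Type) [PartialOrder α] [BoundedOrder α] [Finite α],
      f (of R α) = g (of R α)) : f = g := by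
  refine MonoidAlgebra.lhom_ext' (fun c => LinearMap.ext_ring ?_)
  induction c using PosetClass.ind with | _ α
  exact h α

/-! ### Intervals -/

section

variable {α β : Type} [PartialOrder α] [PartialOrder β]

/-- An isomorphism restricts to lower intervals. -/
def iicCongr (e : α ≃o β) (x : α) : Set.Iic x ≃o Set.Iic (e x) where
  toFun y := ⟨e y, e.monotone y.2⟩
  invFun y := ⟨e.symm y, e.symm_apply_le.2 y.2⟩
  left_inv y := by simp
  right_inv y := by simp
  map_rel_iff' := e.le_iff_le

/-- An isomorphism restricts to upper intervals. -/
def iciCongr (e : α ≃o β) (x : α) : Set.Ici x ≃o Set.Ici (e x) where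
  toFun y := ⟨e y, e.monotone y.2⟩
  invFun y := ⟨e.symm y, e.le_symm_apply.2 y.2⟩
  left_inv y := by simp
  right_inv y := by simp
  map_rel_iff' := e.le_iff_le

/-- Lower intervals of a product are products of lower intervals. -/
def iicProd (x : α × β) : Set.Iic x ≃o Set.Iic x.1 × Set.Iic x.2 where
  toFun y := (⟨y.1.1, y.2.1⟩, ⟨y.1.2, y.2.2⟩)
  invFun y := ⟨(y.1.1, y.2.1), ⟨y.1.2, y.2.2⟩⟩
  left_inv _ := rfl
  right_inv _ := rfl
  map_rel_iff' := Iff.rfl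

/-- Upper intervals of a product are products of upper intervals. -/
def iciProd (x : α × β) : Set.Ici x ≃o Set.Ici x.1 × Set.Ici x.2 where
  toFun y := (⟨y.1.1, y.2.1⟩, ⟨y.1.2, y.2.2⟩)
  invFun y := ⟨(y.1.1, y.2.1), ⟨y.1.2, y.2.2⟩⟩
  left_inv _ := rfl
  right_inv _ := rfl
  map_rel_iff' := Iff.rfl

/-- A lower interval of a lower interval is a lower interval. -/
def iicIic (x : α) (y : Set.Iic x) : Set.Iic y ≃o Set.Iic y.1 where
  toFun z := ⟨z.1.1, z.2⟩
  invFun z := ⟨⟨z.1, le_trans z.2 y.2⟩, z.2⟩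
  left_inv _ := rfl
  right_inv _ := rfl
  map_rel_iff' := Iff.rfl

/-- An upper interval of an upper interval is an upper interval. -/
def iciIci (x : α) (y : Set.Ici x) : Set.Ici y ≃o Set.Ici y.1 where
  toFun z := ⟨z.1.1, z.2⟩
  invFun z := ⟨⟨z.1, le_trans y.2 z.2⟩, z.2⟩
  left_inv _ := rfl
  right_inv _ := rfl
  map_rel_iff' := Iff.rfl

/-- The interval from `y` to `x`, as an interval of `[⊥, x]` and as an interval of `[y, ⊤]`. -/
def iciIic (x y : α) (h : y ≤ x) :
    Set.Ici (⟨y, h⟩ : Set.Iic x) ≃o Set.Iic (⟨x, h⟩ : Set.Ici y) where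
  toFun z := ⟨⟨z.1.1, z.2⟩, z.1.2⟩
  invFun z := ⟨⟨z.1.1, z.2⟩, z.1.2⟩
  left_inv _ := rfl
  right_inv _ := rfl
  map_rel_iff' := Iff.rfl

/-- The lower interval of the maximal element is everything. -/
def iicTop [BoundedOrder α] : Set.Iic (⊤ : α) ≃o α where
  toFun z := z.1
  invFun z := ⟨z, le_top⟩
  left_inv _ := rfl
  right_inv _ := rfl
  map_rel_iff' := Iff.rfl

/-- The upper interval of the minimal element is everything. -/
def iciBot [BoundedOrder α] : Set.Ici (⊥ : α) ≃o α where
  toFun z := z.1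
  invFun z := ⟨z, bot_le⟩
  left_inv _ := rfl
  right_inv _ := rfl
  map_rel_iff' := Iff.rfl

end

/-! ### Coproduct and counit -/

variable (R)

/-- The coproduct `∑ x, [⊥, x] ⊗ [x, ⊤]` of a poset. -/
def comulPoset (α : Type) [PartialOrder α] [BoundedOrder α] [Fintype α] :
    PosetHopf R ⊗[R] PosetHopf R :=
  ∑ x : α, of R (Set.Iic x) ⊗ₜ[R] of R (Set.Ici x)

theorem comulPoset_congr {α β : Type} [PartialOrder α] [BoundedOrder α] [Fintype α]
    [PartialOrder β] [BoundedOrder β] [Fintype β] (e : α ≃o β) :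
    comulPoset R α = comulPoset R β := by
  refine Fintype.sum_equiv e.toEquiv _ _ fun x => ?_
  congr 1
  · exact of_eq_of_iso (iicCongr e x)
  · exact of_eq_of_iso (iciCongr e x)

/-- The coproduct on isomorphism classes. -/
def comulClass : PosetClass →* PosetHopf R ⊗[R] PosetHopf R where
  toFun := Quotient.lift
    (fun P : FinBddPoset => letI := Fintype.ofFinite P.carrier; comulPoset R P.carrier)
    (fun P Q ⟨e⟩ => by
      let _ := Fintype.ofFinite P.carrier
      let _ := Fintype.ofFinite Q.carrier
      exact comulPoset_congr R e)
  map_one' := by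
    change (letI := Fintype.ofFinite Unit; comulPoset R Unit) = 1
    simp [comulPoset, of_eq_one, Algebra.TensorProduct.one_def]
  map_mul' a b := by
    induction a using PosetClass.ind with | _ α
    induction b using PosetClass.ind with | _ β
    let _ := Fintype.ofFinite α
    let _ := Fintype.ofFinite β
    let i3 := Fintype.ofFinite (α × β)
    change comulPoset R (α × β) = comulPoset R α * comulPoset R β
    rw [Subsingleton.elim i3 (instFintypeProd α β)]
    simp only [comulPoset, Fintype.sum_prod_type, Finset.sum_mul_sum,
      Algebra.TensorProduct.tmul_mul_tmul, of_mul_of]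
    refine Finset.sum_congr rfl fun x _ => Finset.sum_congr rfl fun y _ => ?_
    congr 1
    · exact of_eq_of_iso (iicProd (x, y))
    · exact of_eq_of_iso (iciProd (x, y))

theorem comulClass_of (α : Type) [PartialOrder α] [BoundedOrder α] [Fintype α] :
    comulClass R (PosetClass.of α) = comulPoset R α := by
  have : Fintype.ofFinite α = ‹Fintype α› := Subsingleton.elim _ _
  change (letI := Fintype.ofFinite α; comulPoset R α) = _
  rw [this]

open Classical in
/-- The counit on isomorphism classes: one on the one-point poset and zero on all others. -/
def counitClass : PosetClass →* R where
  toFun := Quotient.lift (fun P : FinBddPoset => if Subsingleton P.carrier then (1 : R) else 0)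
    (fun P Q ⟨e⟩ => by simp only [e.toEquiv.subsingleton_congr])
  map_one' := by
    change (if Subsingleton Unit then (1 : R) else 0) = 1
    exact if_pos (inferInstanceAs (Subsingleton Unit))
  map_mul' a b := by
    induction a using PosetClass.ind with | _ α
    induction b using PosetClass.ind with | _ β
    change (if Subsingleton (α × β) then (1 : R) else 0) =
      (if Subsingleton α then (1 : R) else 0) * (if Subsingleton β then (1 : R) else 0)
    have h : Subsingleton (α × β) ↔ Subsingleton α ∧ Subsingleton β := by
      refine ⟨fun h => ⟨?_, ?_⟩, fun ⟨_, _⟩ => inferInstance⟩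
      · exact (Prod.fst_surjective (β := β)).subsingleton
      · exact (Prod.snd_surjective (α := α)).subsingleton
    by_cases ha : Subsingleton α <;> by_cases hb : Subsingleton β <;> simp only [h, ha, hb] <;> simp

open Classical in
theorem counitClass_of (α : Type) [PartialOrder α] [BoundedOrder α] [Finite α] :
    counitClass R (PosetClass.of α) = if Subsingleton α then (1 : R) else 0 := rfl

theorem subsingleton_Iic_iff {α : Type} [PartialOrder α] [BoundedOrder α] (x : α) :
    Subsingleton (Set.Iic x) ↔ x = ⊥ := by
  constructor
  · intro h
    exact congrArg Subtype.val (Subsingleton.elim (⟨x, le_rfl⟩ : Set.Iic x) ⟨⊥, bot_le⟩)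
  · rintro rfl
    exact ⟨fun a b => Subtype.ext ((le_bot_iff.1 a.2).trans (le_bot_iff.1 b.2).symm)⟩

theorem subsingleton_Ici_iff {α : Type} [PartialOrder α] [BoundedOrder α] (x : α) :
    Subsingleton (Set.Ici x) ↔ x = ⊤ := by
  constructor
  · intro h
    exact congrArg Subtype.val (Subsingleton.elim (⟨x, le_rfl⟩ : Set.Ici x) ⟨⊤, le_top⟩)
  · rintro rfl
    exact ⟨fun a b => Subtype.ext ((top_le_iff.1 a.2).trans (top_le_iff.1 b.2).symm)⟩

open Classical in
/-- The bialgebra structure: `Δ(P) = ∑ x ∈ P, [⊥, x] ⊗ [x, ⊤]`, and `ε(P)` is one if `P` has one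
element and zero otherwise. -/
instance : Bialgebra R (PosetHopf R) :=
  Bialgebra.ofAlgHom (liftHom R (comulClass R)) (liftHom R (counitClass R))
    (algHom_ext fun α _ _ _ => by
      let _ := Fintype.ofFinite α
      simp only [AlgHom.comp_apply, liftHom_of, comulClass_of, comulPoset, map_sum,
        Algebra.TensorProduct.map_tmul, AlgHom.id_apply, TensorProduct.sum_tmul,
        TensorProduct.tmul_sum]
      rw [Finset.sum_sigma', Finset.sum_sigma']
      refine Fintype.sum_equiv
        { toFun := fun p => ⟨p.2.1, ⟨p.1, p.2.2⟩⟩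
          invFun := fun p => ⟨p.2.1, ⟨p.1, p.2.2⟩⟩
          left_inv := fun _ => rfl
          right_inv := fun _ => rfl } _ _ fun p => ?_
      obtain ⟨x, y, h⟩ := p
      dsimp only [Equiv.coe_fn_mk]
      rw [of_eq_of_iso (iicIic x ⟨y, h⟩), of_eq_of_iso (iciIic x y h),
        of_eq_of_iso (iciIci y ⟨x, h⟩)]
      rfl)
    (algHom_ext fun α _ _ _ => by
      let _ := Fintype.ofFinite α
      simp only [AlgHom.comp_apply, liftHom_of, comulClass_of, comulPoset, map_sum,
        Algebra.TensorProduct.map_tmul, AlgHom.id_apply, counitClass_of, subsingleton_Iic_iff]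
      rw [Finset.sum_eq_single ⊥]
      · simp [of_eq_of_iso (iciBot (α := α))]
      · intro x _ hx
        simp [hx]
      · simp)
    (algHom_ext fun α _ _ _ => by
      let _ := Fintype.ofFinite α
      simp only [AlgHom.comp_apply, liftHom_of, comulClass_of, comulPoset, map_sum,
        Algebra.TensorProduct.map_tmul, AlgHom.id_apply, counitClass_of, subsingleton_Ici_iff]
      rw [Finset.sum_eq_single ⊤]
      · simp [of_eq_of_iso (iicTop (α := α))]
      · intro x _ hx
        simp [hx]
      · simp)

theorem comul_of (α : Type) [PartialOrder α] [BoundedOrder α] [Fintype α] :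
    Coalgebra.comul (R := R) (of R α) = ∑ x : α, of R (Set.Iic x) ⊗ₜ[R] of R (Set.Ici x) :=
  (liftHom_of (comulClass R) α).trans (comulClass_of R α)

open Classical in
theorem counit_of (α : Type) [PartialOrder α] [BoundedOrder α] [Finite α] :
    Coalgebra.counit (R := R) (of R α) = if Subsingleton α then (1 : R) else 0 :=
  liftHom_of (counitClass R) α

/-! ### Antipode -/

/-- The convolution product of linear maps, evaluated at a poset. -/
theorem convMul_of (f g : WithConv (PosetHopf R →ₗ[R] PosetHopf R)) (α : Type)
    [PartialOrder α] [BoundedOrder α] [Fintype α] :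
    (f * g).ofConv (of R α) =
      ∑ x : α, f.ofConv (of R (Set.Iic x)) * g.ofConv (of R (Set.Ici x)) := by
  change LinearMap.mul' R _ (TensorProduct.map f.ofConv g.ofConv (Coalgebra.comul (of R α))) = _
  simp [comul_of]

/-- The map `η ∘ ε - id`. -/
def augment : WithConv (PosetHopf R →ₗ[R] PosetHopf R) := 1 - toConv LinearMap.id

theorem augment_of_subsingleton (α : Type) [PartialOrder α] [BoundedOrder α] [Finite α]
    [h : Subsingleton α] : (augment R).ofConv (of R α) = 0 := by
  change algebraMap R _ (Coalgebra.counit (of R α)) - of R α = 0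
  simp [of_eq_one]

theorem card_Iic_lt {α : Type} [PartialOrder α] [BoundedOrder α] [Finite α] {x : α}
    (hx : x ≠ ⊤) : Nat.card (Set.Iic x) < Nat.card α := by
  have : Set.Iic x ⊂ Set.univ := by
    refine Set.ssubset_univ_iff.2 fun h => hx (top_le_iff.1 ?_)
    have : (⊤ : α) ∈ Set.Iic x := h ▸ Set.mem_univ _
    exact this
  simpa using Set.ncard_lt_ncard this

theorem card_Ici_lt {α : Type} [PartialOrder α] [BoundedOrder α] [Finite α] {x : α}
    (hx : x ≠ ⊥) : Nat.card (Set.Ici x) < Nat.card α := by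
  have : Set.Ici x ⊂ Set.univ := by
    refine Set.ssubset_univ_iff.2 fun h => hx (le_bot_iff.1 ?_)
    have : (⊥ : α) ∈ Set.Ici x := h ▸ Set.mem_univ _
    exact this
  simpa using Set.ncard_lt_ncard this

theorem augment_pow_of (k : ℕ) (α : Type) [PartialOrder α] [BoundedOrder α] [Finite α]
    (h : Nat.card α ≤ k) : (augment R ^ k).ofConv (of R α) = 0 := by
  induction k generalizing α with
  | zero => exact absurd h (by simpa using Nat.card_pos.ne')
  | succ k ih =>
    let _ := Fintype.ofFinite α
    rw [pow_succ, convMul_of]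
    refine Finset.sum_eq_zero fun x _ => ?_
    by_cases hx : x = ⊤
    · have := (subsingleton_Ici_iff x).2 hx
      rw [augment_of_subsingleton, mul_zero]
    · rw [ih _ (by have := card_Iic_lt hx; omega), zero_mul]

/-- The geometric series of the map `η ∘ ε - id`, up to exponent `N - 1`. -/
def geomSeries (N : ℕ) : WithConv (PosetHopf R →ₗ[R] PosetHopf R) :=
  ∑ k ∈ Finset.range N, augment R ^ k

theorem geomSeries_of {N : ℕ} (α : Type) [PartialOrder α] [BoundedOrder α] [Finite α]
    (h : Nat.card α ≤ N) :
    (geomSeries R N).ofConv (of R α) = (geomSeries R (Nat.card α)).ofConv (of R α) := by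
  induction N, h using Nat.le_induction with
  | base => rfl
  | succ N h ih =>
    have : geomSeries R (N + 1) = geomSeries R N + augment R ^ N := Finset.sum_range_succ _ _
    rw [this, ← ih]
    change (geomSeries R N).ofConv (of R α) + (augment R ^ N).ofConv (of R α) = _
    rw [augment_pow_of R N α h, add_zero]

/-- The inverse of the identity under convolution: on a poset `P`, the (finite) sum of the
convolution powers of `η ∘ ε - id`. The instance below proves that this is the antipode. -/
def antipodeMap : PosetHopf R →ₗ[R] PosetHopf R :=
  (basis R).constr R fun c =>
    (geomSeries R c.card).ofConv (ofClass R c)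

theorem antipodeMap_of {N : ℕ} (α : Type) [PartialOrder α] [BoundedOrder α] [Finite α]
    (h : Nat.card α ≤ N) : antipodeMap R (of R α) = (geomSeries R N).ofConv (of R α) := by
  rw [geomSeries_of R α h]
  exact (basis R).constr_basis R _ (PosetClass.of α)

/-- The Hopf algebra of finite posets with `⊥` and `⊤`. -/
instance : HopfAlgebra R (PosetHopf R) :=
  HopfAlgebra.ofConvInverse (antipodeMap R)
    (by
      refine WithConv.ext (linearMap_ext fun α _ _ _ => ?_)
      let _ := Fintype.ofFinite α
      have key : geomSeries R (Nat.card α) * toConv LinearMap.id =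
          1 - augment R ^ Nat.card α := by
        have : toConv LinearMap.id = 1 - augment R := by simp [augment]
        rw [this, geomSeries, geom_sum_mul_neg]
      have key2 := congrArg (fun f => f.ofConv (of R α)) key
      simp only [convMul_of] at key2
      rw [convMul_of]
      refine Eq.trans (Finset.sum_congr rfl fun x _ => ?_) (key2.trans ?_)
      · rw [← antipodeMap_of R (Set.Iic x)
          (Nat.card_le_card_of_injective _ Subtype.val_injective)]
      · change (1 : WithConv (PosetHopf R →ₗ[R] PosetHopf R)).ofConv (of R α) -
          (augment R ^ Nat.card α).ofConv (of R α) = _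
        rw [augment_pow_of R _ α le_rfl, sub_zero])
    (by
      refine WithConv.ext (linearMap_ext fun α _ _ _ => ?_)
      let _ := Fintype.ofFinite α
      have key : toConv LinearMap.id * geomSeries R (Nat.card α) =
          1 - augment R ^ Nat.card α := by
        have : toConv LinearMap.id = 1 - augment R := by simp [augment]
        rw [this, geomSeries, mul_neg_geom_sum]
      have key2 := congrArg (fun f => f.ofConv (of R α)) key
      simp only [convMul_of] at key2
      rw [convMul_of]
      refine Eq.trans (Finset.sum_congr rfl fun x _ => ?_) (key2.trans ?_)
      · rw [← antipodeMap_of R (Set.Ici x)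
          (Nat.card_le_card_of_injective _ Subtype.val_injective)]
      · change (1 : WithConv (PosetHopf R →ₗ[R] PosetHopf R)).ofConv (of R α) -
          (augment R ^ Nat.card α).ofConv (of R α) = _
        rw [augment_pow_of R _ α le_rfl, sub_zero])

end PosetHopf

/-! ## Noncrossing partitions -/

/-- A family of sets is noncrossing if there are no `i < j < k < l` such that `i` and `k` belong
to one of the sets, and `j` and `l` to another one. -/
def IsNoncrossing {n : ℕ} (F : Finset (Finset (Fin n))) : Prop :=
  ∀ B ∈ F, ∀ C ∈ F, B ≠ C →
    ¬ ∃ i j k l : Fin n, i < j ∧ j < k ∧ k < l ∧ i ∈ B ∧ k ∈ B ∧ j ∈ C ∧ l ∈ C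

/-- The Kreweras dual of a noncrossing partition, as an equivalence relation. The point `i'` lies
on the circle between `i` and `i + 1`, so that `a ≤ i ↔ a ≤ j` fails exactly if the chord from `i'`
to `j'` separates `a` from the starting point of the circle. Two points `i'` and `j'` lie in the
same region of the complement of the convex hulls of the blocks if and only if every block lies
entirely on one side of this chord. -/
def krewerasSetoid {n : ℕ} (π : Finpartition (Finset.univ : Finset (Fin n))) : Setoid (Fin n) where
  r i j := ∀ B ∈ π.parts, (∀ a ∈ B, (a ≤ i ↔ a ≤ j)) ∨ (∀ a ∈ B, ¬ (a ≤ i ↔ a ≤ j))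
  iseqv :=
    { refl := fun _ _ _ => Or.inl fun _ _ => Iff.rfl
      symm := fun h B hB => (h B hB).imp (fun g a ha => (g a ha).symm)
        (fun g a ha h' => g a ha h'.symm)
      trans := fun {x y z} h h' B hB => by
        rcases h B hB with g | g <;> rcases h' B hB with g' | g'
        · exact Or.inl fun a ha => (g a ha).trans (g' a ha)
        · exact Or.inr fun a ha h => g' a ha ((g a ha).symm.trans h)
        · exact Or.inr fun a ha h => g a ha (h.trans (g' a ha).symm)
        · refine Or.inl fun a ha => ?_
          have h1 := g a ha
          have h2 := g' a ha
          tauto }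

instance {n : ℕ} (π : Finpartition (Finset.univ : Finset (Fin n))) :
    DecidableRel (krewerasSetoid π).r := fun i j =>
  inferInstanceAs (Decidable
    (∀ B ∈ π.parts, (∀ a ∈ B, (a ≤ i ↔ a ≤ j)) ∨ (∀ a ∈ B, ¬ (a ≤ i ↔ a ≤ j))))

/-- The Kreweras dual of a noncrossing partition. -/
def krewerasDual {n : ℕ} (π : Finpartition (Finset.univ : Finset (Fin n))) :
    Finpartition (Finset.univ : Finset (Fin n)) :=
  Finpartition.ofSetoid (krewerasSetoid π)

/-- A partition is `d`-indivisible if the blocks of the partition and of its Kreweras dual have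
cardinality congruent to `1` modulo `d`. -/
def IsIndivisible (d : ℕ) {n : ℕ} (π : Finpartition (Finset.univ : Finset (Fin n))) : Prop :=
  (∀ B ∈ π.parts, B.card ≡ 1 [MOD d]) ∧ ∀ C ∈ (krewerasDual π).parts, C.card ≡ 1 [MOD d]

/-- The set of `d`-indivisible noncrossing partitions of `n` points. -/
def NC (d n : ℕ) : Type :=
  {π : Finpartition (Finset.univ : Finset (Fin n)) // IsNoncrossing π.parts ∧ IsIndivisible d π}

namespace NC

variable {d n : ℕ}

/-- The `d`-indivisible noncrossing partitions are ordered by refinement. -/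
instance : PartialOrder (NC d n) :=
  inferInstanceAs (PartialOrder {π : Finpartition (Finset.univ : Finset (Fin n)) //
    IsNoncrossing π.parts ∧ IsIndivisible d π})

theorem le_def (π σ : NC d n) : π ≤ σ ↔ ∀ B ∈ π.1.parts, ∃ C ∈ σ.1.parts, B ⊆ C := Iff.rfl

instance : Finite (NC d n) :=
  inferInstanceAs (Finite {π : Finpartition (Finset.univ : Finset (Fin n)) //
    IsNoncrossing π.parts ∧ IsIndivisible d π})

theorem mem_bot (h : n ≡ 1 [MOD d]) :
    IsNoncrossing (⊥ : Finpartition (Finset.univ : Finset (Fin n))).parts ∧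
      IsIndivisible d (⊥ : Finpartition (Finset.univ : Finset (Fin n))) := by
  refine ⟨?_, ?_, ?_⟩
  · rintro B hB C - - ⟨i, j, k, l, hij, hjk, -, hi, hk, -, -⟩
    obtain ⟨a, -, rfl⟩ := Finpartition.mem_bot_iff.1 hB
    rw [Finset.mem_singleton] at hi hk
    subst hi hk
    exact absurd (hij.trans hjk) (lt_irrefl _)
  · intro B hB
    obtain ⟨a, -, rfl⟩ := Finpartition.mem_bot_iff.1 hB
    rfl
  · intro C hC
    obtain ⟨i, hi⟩ := Finpartition.nonempty_of_mem_parts _ hC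
    have : C = Finset.univ := by
      refine Finset.eq_univ_iff_forall.2 fun j => ?_
      rw [← Finpartition.part_eq_of_mem _ hC hi]
      refine Finpartition.mem_part_ofSetoid_iff_rel.2 fun B hB => ?_
      obtain ⟨a, -, rfl⟩ := Finpartition.mem_bot_iff.1 hB
      by_cases h : a ≤ i ↔ a ≤ j
      · exact Or.inl (by simpa using h)
      · exact Or.inr (by simpa using h)
    simpa [this] using h

theorem mem_top (h : n ≡ 1 [MOD d]) :
    IsNoncrossing (⊤ : Finpartition (Finset.univ : Finset (Fin n))).parts ∧
      IsIndivisible d (⊤ : Finpartition (Finset.univ : Finset (Fin n))) := by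
  have hU : ∀ B ∈ (⊤ : Finpartition (Finset.univ : Finset (Fin n))).parts, B = Finset.univ :=
    fun B hB => Finset.mem_singleton.1 (Finpartition.parts_top_subset _ hB)
  refine ⟨?_, ?_, ?_⟩
  · intro B hB C hC hBC
    exact absurd ((hU B hB).trans (hU C hC).symm) hBC
  · intro B hB
    simpa [hU B hB] using h
  · intro C hC
    obtain ⟨i, hi⟩ := Finpartition.nonempty_of_mem_parts _ hC
    have : C = {i} := by
      refine Finset.eq_singleton_iff_unique_mem.2 ⟨hi, fun j hj => ?_⟩
      rw [← Finpartition.part_eq_of_mem _ hC hi] at hj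
      have hr : krewerasSetoid ⊤ i j := Finpartition.mem_part_ofSetoid_iff_rel.1 hj
      obtain ⟨B, hB, -⟩ := Finpartition.exists_mem
        (⊤ : Finpartition (Finset.univ : Finset (Fin n))) (Finset.mem_univ i)
      have hB' := hU B hB
      subst hB'
      let z : Fin n := ⟨0, i.pos⟩
      have hz : z ≤ i ↔ z ≤ j :=
        iff_of_true (Fin.mk_le_of_le_val (Nat.zero_le _)) (Fin.mk_le_of_le_val (Nat.zero_le _))
      rcases hr _ hB with g | g
      · exact le_antisymm ((g j (Finset.mem_univ _)).2 le_rfl) ((g i (Finset.mem_univ _)).1 le_rfl)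
      · exact absurd hz (g z (Finset.mem_univ _))
    rw [this]
    rfl

/-- If `n` is congruent to `1` modulo `d`, then the partition into singletons is the minimal
element and the partition with one block is the maximal element. -/
abbrev boundedOrder (h : n ≡ 1 [MOD d]) : BoundedOrder (NC d n) where
  top := ⟨⊤, mem_top h⟩
  bot := ⟨⊥, mem_bot h⟩
  le_top π := le_top (a := π.1)
  bot_le π := bot_le (a := π.1)

/-- The poset of `d`-indivisible noncrossing partitions of `n` points, as an element of the Hopf
algebra of posets. -/
def toHopf (R : Type*) [CommRing R] (d n : ℕ) (h : n ≡ 1 [MOD d]) : PosetHopf R :=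
  letI := boundedOrder h
  PosetHopf.of R (NC d n)

end NC

/-! ## Noncrossing hypertrees -/

/-- A hypergraph is a set of edges, each of which has at least two elements. -/
def IsHypergraph {n : ℕ} (T : Finset (Finset (Fin n))) : Prop := ∀ E ∈ T, 2 ≤ E.card

/-- Any two different vertices are connected by a sequence of edges such that consecutive edges
intersect. -/
def IsConnectedHypergraph {n : ℕ} (T : Finset (Finset (Fin n))) : Prop :=
  ∀ x y : Fin n, x ≠ y → ∃ E ∈ T, ∃ F ∈ T, x ∈ E ∧ y ∈ F ∧
    Relation.ReflTransGen (fun A B => A ∈ T ∧ B ∈ T ∧ (A ∩ B).Nonempty) E F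

/-- A connected hypergraph on `n` points is a hypertree if the sum of `|E| - 1` over all edges `E`
is `n - 1`. -/
def IsHypertree {n : ℕ} (T : Finset (Finset (Fin n))) : Prop :=
  IsHypergraph T ∧ IsConnectedHypergraph T ∧ ∑ E ∈ T, ((E.card : ℤ) - 1) = (n : ℤ) - 1

/-- The noncrossing hypertrees on `n` points all of whose edges have cardinality congruent to `1`
modulo `d`. -/
def NCHypertree (d n : ℕ) : Type :=
  {T : Finset (Finset (Fin n)) // IsHypertree T ∧ IsNoncrossing T ∧ ∀ E ∈ T, E.card ≡ 1 [MOD d]}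

namespace NCHypertree

variable {d n : ℕ}

instance : Finite (NCHypertree d n) :=
  inferInstanceAs (Finite {T : Finset (Finset (Fin n)) //
    IsHypertree T ∧ IsNoncrossing T ∧ ∀ E ∈ T, E.card ≡ 1 [MOD d]})

instance : Fintype (NCHypertree d n) := Fintype.ofFinite _

/-- The set of edges. -/
def edges (T : NCHypertree d n) : Finset (Finset (Fin n)) := T.1

theorem card_edge (T : NCHypertree d n) (E : T.edges) : E.1.card ≡ 1 [MOD d] := T.2.2.2 E.1 E.2

end NCHypertree

end

/-! The antipode satisfies `∑ π, S([⊥, π]) * [π, ⊤] = ε`. In `NC d n`, the interval `[⊥, π]` is the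
product of the posets `NC d |B|` over the blocks `B` of `π`, and `[π, ⊤]` is the product of the `NC
d |C|` over the blocks `C` of the Kreweras dual. For `n ≥ 2` the counit vanishes, the term of `π =
⊤` is `S(NC d n)` itself, and all other terms involve antipodes of smaller posets only. So it
suffices that the signed sums over noncrossing trees, `treeSum`, obey the same recursion
(`sum_prod_treeSum`).

A partition `π` together with a noncrossing tree on each block is a noncrossing forest `F` with
components `π` (`prod_treeSum`). The recursion thus says that the signed weights of all forests,
each multiplied by the weights of the dual classes of its components, cancel. Dual classes with one
element have weight one and are discarded. Read a dual class `C` as a set of vertices, replacing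
`i'` by `i`. Then `insert C F` is again a noncrossing forest; in its dual, `C` falls apart into
singletons and nothing else changes (`dualClasses_insert`). So the union of the edges and the dual
classes, `completion F`, stays the same, and so does the total weight, up to a sign. Conversely, an
edge of `F` can be moved to the dual if it is outermost in the completion (`mem_dualClasses_erase`).
For `n ≥ 2` an outermost member always exists (`exists_isOutermost`): any dual class is one, and if
there is none then `F` is a tree, where a pigeonhole argument finds one. The choice of this member
depends on the completion only, so moving it is a sign reversing involution.

The products of intervals need an argument because indivisibility involves the dual, which is not
local to a block. If `n ≡ 1` modulo `d` and all blocks have size `1` modulo `d`, then the condition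
on the dual is equivalent to this: between any two elements of a block, the number of points outside
the block is divisible by `d`. This condition can be tested on the blocks of a coarser indivisible
partition, which yields the lower intervals. The upper intervals follow because the Kreweras dual
reverses the order, and its square is a rotation. -/

/-! ## Noncrossing equivalence relations and their Kreweras duals -/

namespace Noncrossing

open Finset

/-- An equivalence relation is noncrossing if no two different classes cross. -/
def IsNoncr {α : Type*} [LinearOrder α] (s : Setoid α) : Prop :=
  ∀ i j k l : α, i < j → j < k → k < l → s i k → s j l → s i j

/-- The points `a` and `b` are on the same side of the chord from `p'` to `q'`. -/
def SameSide {n : ℕ} (p q a b : Fin n) : Prop := ((a ≤ p ↔ a ≤ q) ↔ (b ≤ p ↔ b ≤ q))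

variable {n : ℕ}

/-- The Kreweras dual of an equivalence relation. -/
def kr (s : Setoid (Fin n)) : Setoid (Fin n) where
  r p q := ∀ a b, s a b → SameSide p q a b
  iseqv :=
    { refl := fun _ _ _ _ => by simp [SameSide]
      symm := fun h a b hab => by have := h a b hab; simp only [SameSide] at *; tauto
      trans := fun h h' a b hab => by
        have := h a b hab
        have := h' a b hab
        simp only [SameSide] at *
        tauto }

theorem SameSide.swap {p q a b : Fin n} (h : SameSide p q a b) : SameSide q p a b := by
  simp only [SameSide] at *; tauto

theorem SameSide.trans {p q a b c : Fin n} (h : SameSide p q a b) (h' : SameSide p q b c) :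
    SameSide p q a c := Iff.trans h h'

theorem sameSide_iff_of_lt {p q a b : Fin n} (h : p < q) :
    SameSide p q a b ↔ (p < a ∧ a ≤ q ↔ p < b ∧ b ≤ q) := by
  simp only [SameSide]
  omega

theorem kr_of_lt {s : Setoid (Fin n)} {p q : Fin n} (hpq : p < q)
    (h : ∀ u v, s u v → p < u → u ≤ q → p < v ∧ v ≤ q) : kr s p q := by
  intro a b hab
  rw [sameSide_iff_of_lt hpq]
  exact ⟨fun ha => h a b hab ha.1 ha.2, fun hb => h b a (s.symm' hab) hb.1 hb.2⟩

theorem kr_lt {s : Setoid (Fin n)} {p q u v : Fin n} (h : kr s p q) (huv : s u v) (hu : p < u)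
    (hu' : u ≤ q) : p < v ∧ v ≤ q :=
  ((sameSide_iff_of_lt (hu.trans_le hu')).1 (h u v huv)).1 ⟨hu, hu'⟩

theorem kr_antitone {s t : Setoid (Fin n)} (h : s ≤ t) : kr t ≤ kr s :=
  fun _ _ hpq a b hab => hpq a b (h hab)

theorem isNoncr_kr (s : Setoid (Fin n)) : IsNoncr (kr s) := by
  intro i j k l hij hjk hkl hik hjl a b hab
  have h1 := hik a b hab
  have h2 := hjl a b hab
  simp only [SameSide] at *
  omega

theorem eq_of_kr {s : Setoid (Fin n)} {p q : Fin n} (h : s p q) (h' : kr s p q) : p = q := by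
  have := h' p q h
  simp only [SameSide] at this
  omega

/-- The mirror image of `kr_lt`: the point `p'` lies just after `p`, so the half-open interval that
a chord of `s` cuts out of the dual points is closed on the left. -/
theorem kr_between {s : Setoid (Fin n)} {a b p q : Fin n} (hs : s a b) (hab : a < b)
    (h : kr s p q) (hp : a ≤ p ∧ p < b) : a ≤ q ∧ q < b := by
  have := h a b hs
  simp only [SameSide] at this
  omega

/-- The gap between two consecutive elements of a class is the difference of two points in the same
class of the dual. -/
theorem kr_gap {s : Setoid (Fin n)} (hs : IsNoncr s) {p q y : Fin n} (hpy : p < y) (h : s p y)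
    (hgap : ∀ u, p < u → u < y → ¬ s p u) (hq : q.val + 1 = y.val) : kr s p q := by
  rcases eq_or_lt_of_le (show p ≤ q by omega) with rfl | hpq
  · exact (kr s).refl' _
  refine kr_of_lt hpq fun u v huv hu hu' => ?_
  have huy : u < y := by omega
  have hnu := hgap u hu huy
  have hnv : ¬ s p v := fun hv => hnu (s.trans' hv (s.symm' huv))
  have hvp : v ≠ p := by rintro rfl; exact hnv (s.refl' _)
  have hvy : v ≠ y := by rintro rfl; exact hnv h
  have h1 : ¬ v < p := fun hv => hnv (s.symm' (hs v p u y hv hu huy (s.symm' huv) h))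
  have h2 : ¬ y < v := fun hv => hnu (hs p u y v hu huy hv h huv)
  omega

/-- The point before the minimum of a class is dual to the maximum of the class. -/
theorem kr_pred_max {s : Setoid (Fin n)} (hs : IsNoncr s) {m p q : Fin n} (h : s m p)
    (hm : ∀ x, s m x → m ≤ x) (hp : ∀ x, s m x → x ≤ p) (hq : q.val + 1 = m.val) : kr s q p := by
  have hmp := hm p h
  refine kr_of_lt (by omega) fun u v huv hu hup => ?_
  suffices h : m ≤ v ∧ v ≤ p by omega
  by_cases hau : s m u
  · exact ⟨hm v (s.trans' hau huv), hp v (s.trans' hau huv)⟩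
  have hum : u ≠ m := by rintro rfl; exact hau (s.refl' _)
  have hup' : u ≠ p := by rintro rfl; exact hau h
  have h1 : ¬ p < v := fun hv => hau (hs m u p v (by omega) (by omega) hv h huv)
  have h2 : ¬ v < m := fun hv =>
    hau (s.trans' (s.symm' (hs v m u p hv (by omega) (by omega) (s.symm' huv) h)) (s.symm' huv))
  omega

/-- The last point is dual to the maximum of the class of the first point. -/
theorem kr_last {s : Setoid (Fin n)} (hs : IsNoncr s) {m p q : Fin n} (h : s m p)
    (hm : m.val = 0) (hp : ∀ x, s m x → x ≤ p) (hq : q.val + 1 = n) : kr s p q := by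
  rcases eq_or_lt_of_le (show p ≤ q by omega) with rfl | hpq
  · exact (kr s).refl' _
  refine kr_of_lt hpq fun u v huv hu _ => ⟨?_, by omega⟩
  have hnu : ¬ s m u := fun hau => absurd (hp u hau) (not_le.2 hu)
  have hnv : ¬ s m v := fun hv => hnu (s.trans' hv (s.symm' huv))
  have hvp : v ≠ p := by rintro rfl; exact hnv h
  have hvm : v ≠ m := by rintro rfl; exact hnv (s.refl' _)
  have h1 : ¬ v < p := fun hv => hnv (hs m v p u (by omega) hv hu h (s.symm' huv))
  omega

/-! ### Recovering a noncrossing relation from its dual -/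

theorem exists_max {α : Type*} [LinearOrder α] [Finite α] {P : α → Prop} (h : ∃ x, P x) :
    ∃ x, P x ∧ ∀ y, P y → y ≤ x := by
  obtain ⟨x, hx, hm⟩ := Set.exists_max_image {x | P x} id (Set.toFinite _) h
  exact ⟨x, hx, hm⟩

theorem exists_min {α : Type*} [LinearOrder α] [Finite α] {P : α → Prop} (h : ∃ x, P x) :
    ∃ x, P x ∧ ∀ y, P y → x ≤ y := by
  obtain ⟨x, hx, hm⟩ := Set.exists_min_image {x | P x} id (Set.toFinite _) h
  exact ⟨x, hx, hm⟩

/-- If `a` and `b` are not in the same class, then the dual connects the two arcs between them. -/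
theorem exists_kr_separating {s : Setoid (Fin n)} (hs : IsNoncr s) {a b : Fin n} (hab : a < b)
    (h : ¬ s a b) : ∃ p q, kr s p q ∧ (a ≤ p ∧ p < b) ∧ ¬ (a ≤ q ∧ q < b) := by
  -- `p` is the last element before `b` of the class of `a`. The partner `q` lies just before the
  -- element of this class that cyclically follows `p`: beyond `b`, or, after wrapping around,
  -- before the minimum of the class.
  obtain ⟨p, hp, hpm⟩ := exists_max (P := fun x => s a x ∧ x < b) ⟨a, s.refl' a, hab⟩
  have hap : a ≤ p := hpm a ⟨s.refl' a, hab⟩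
  have hnb : ∀ x, s a x → x ≠ b := by rintro x hx rfl; exact h hx
  by_cases hy : ∃ y, s a y ∧ b < y
  · obtain ⟨y, hy, hym⟩ := exists_min hy
    refine ⟨p, ⟨y.val - 1, by omega⟩, kr_gap hs (y := y) (by omega)
      (s.trans' (s.symm' hp.1) hy.1) ?_ ?_, ⟨hap, hp.2⟩, ?_⟩
    · intro u hu huy hpu
      have hau := s.trans' hp.1 hpu
      rcases lt_trichotomy u b with h1 | h1 | h1
      · exact absurd (hpm u ⟨hau, h1⟩) (not_le.2 hu)
      · exact hnb u hau h1
      · exact absurd (hym u ⟨hau, h1⟩) (not_le.2 huy)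
    · simp only; omega
    · rintro ⟨h1, h2⟩
      rw [Fin.lt_def] at h2
      simp only at h2
      omega
  · push Not at hy
    obtain ⟨m, hm, hmm⟩ := exists_min (P := fun x => s a x) ⟨a, s.refl' a⟩
    have hma := hmm a (s.refl' a)
    have hmax : ∀ x, s m x → x ≤ p := fun x hx =>
      hpm x ⟨s.trans' hm hx, lt_of_le_of_ne (hy x (s.trans' hm hx)) (hnb x (s.trans' hm hx))⟩
    have hmp : s m p := s.trans' (s.symm' hm) hp.1
    by_cases hm0 : m.val = 0
    · refine ⟨p, ⟨n - 1, by omega⟩, kr_last hs hmp hm0 hmax ?_, ⟨hap, hp.2⟩, ?_⟩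
      · simp only; omega
      · rintro ⟨h1, h2⟩
        rw [Fin.lt_def] at h2
        simp only at h2
        omega
    · refine ⟨p, ⟨m.val - 1, by omega⟩, (kr s).symm' (kr_pred_max hs hmp
        (fun x hx => hmm x (s.trans' hm hx)) hmax ?_), ⟨hap, hp.2⟩, ?_⟩
      · simp only; omega
      · rintro ⟨h1, h2⟩
        rw [Fin.le_def] at h1
        simp only at h1
        omega

theorem rel_iff_kr {s : Setoid (Fin n)} (hs : IsNoncr s) {a b : Fin n} (hab : a < b) :
    s a b ↔ ∀ p q, kr s p q → a ≤ p ∧ p < b → a ≤ q ∧ q < b := by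
  refine ⟨fun h p q hpq hp => kr_between h hab hpq hp, fun h => ?_⟩
  by_contra hn
  obtain ⟨p, q, hpq, hp, hq⟩ := exists_kr_separating hs hab hn
  exact hq (h p q hpq hp)

/-- By `rel_iff_kr`, a noncrossing relation can be read off from its dual, with fewer dual relations
giving more relations. With `kr_antitone` this makes the dual an order reversing embedding. -/
theorem le_of_kr_le {s t : Setoid (Fin n)} (ht : IsNoncr t) (h : kr t ≤ kr s) : s ≤ t := by
  have key : ∀ a b, a < b → s a b → t a b := fun a b hab hs =>
    (rel_iff_kr ht hab).2 fun p q hpq hp => kr_between hs hab (h hpq) hp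
  intro a b hs
  rcases lt_trichotomy a b with hab | rfl | hab
  · exact key a b hab hs
  · exact t.refl' a
  · exact t.symm' (key b a hab (s.symm' hs))

/-- The dual of the dual is a rotation. -/
theorem kr_kr {s : Setoid (Fin (n + 1))} (hs : IsNoncr s) (i j : Fin (n + 1)) :
    kr (kr s) i j ↔ s (i + 1) (j + 1) := by
  wlog hij : i < j generalizing i j
  · rcases lt_trichotomy i j with h | rfl | h
    · exact this i j h
    · exact iff_of_true ((kr (kr s)).refl' i) (s.refl' _)
    · have := this j i h
      exact ⟨fun h => s.symm' (this.1 ((kr (kr s)).symm' h)),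
        fun h => (kr (kr s)).symm' (this.2 (s.symm' h))⟩
  have hi : (i + 1).val = i.val + 1 := Fin.val_add_one_of_lt (hij.trans_le (Fin.le_last j))
  -- The double dual tests the interval from `i + 1` to `j`. If `j` is the last point, then `j + 1`
  -- wraps around to `0`, and the complementary interval `[0, i + 1)` is used.
  by_cases hj : j = Fin.last n
  · subst hj
    have h0 : (Fin.last n + 1 : Fin (n + 1)) = 0 := Fin.last_add_one n
    have hlt : (0 : Fin (n + 1)) < i + 1 := by rw [Fin.lt_def, hi]; simp
    rw [h0, s.comm', rel_iff_kr hs hlt]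
    constructor
    · intro h p q hpq hp
      have := h p q hpq
      rw [sameSide_iff_of_lt hij] at this
      have := Fin.le_last p
      have := Fin.le_last q
      simp only [Fin.lt_def, Fin.le_def, hi, Fin.val_zero] at *
      omega
    · intro h
      refine (kr (kr s)).symm' ?_
      intro p q hpq
      have h1 := h p q hpq
      have h2 := h q p ((kr s).symm' hpq)
      refine SameSide.swap ?_
      rw [sameSide_iff_of_lt hij]
      have := Fin.le_last p
      have := Fin.le_last q
      simp only [Fin.lt_def, Fin.le_def, hi, Fin.val_zero] at *
      omega
  · have hj : (j + 1).val = j.val + 1 := Fin.val_add_one_of_lt (lt_of_le_of_ne (Fin.le_last j) hj)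
    have hlt : i + 1 < j + 1 := by rw [Fin.lt_def, hi, hj]; omega
    rw [rel_iff_kr hs hlt]
    constructor
    · intro h p q hpq hp
      have := h p q hpq
      rw [sameSide_iff_of_lt hij] at this
      simp only [Fin.lt_def, Fin.le_def, hi, hj] at *
      omega
    · intro h p q hpq
      have h1 := h p q hpq
      have h2 := h q p ((kr s).symm' hpq)
      rw [sameSide_iff_of_lt hij]
      simp only [Fin.lt_def, Fin.le_def, hi, hj] at *
      omega

/-! ## Classes and gaps modulo `d` -/

open Classical in
/-- All classes have cardinality congruent to `1` modulo `d`. -/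
def ClassesOne {α : Type*} [Fintype α] (d : ℕ) (s : Setoid α) : Prop :=
  ∀ x, ((univ.filter fun z => s x z).card : ZMod d) = 1

open Classical in
/-- The number of elements between two elements of a class that do not belong to the class is
divisible by `d`. -/
def GapsZero {α : Type*} [LinearOrder α] [Fintype α] (d : ℕ) (s : Setoid α) : Prop :=
  ∀ x y, s x y → ((univ.filter fun z => x < z ∧ z < y ∧ ¬ s x z).card : ZMod d) = 0

section

variable {α : Type*} [LinearOrder α] [Fintype α] {d : ℕ}

-- A union of classes has, modulo `d`, as many elements as it contains classes; the classes are
-- counted by their representatives, the fixed points of `f`.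
open Classical in
theorem card_eq_card_fixed {s : Setoid α} {f : α → α} (hf : ∀ z, s z (f z))
    (hf' : ∀ z w, s z w → f z = f w) (hs : ClassesOne d s) (S : Finset α)
    (hS : ∀ z ∈ S, ∀ w, s z w → w ∈ S) : (S.card : ZMod d) = (S.filter fun z => f z = z).card := by
  have h1 : ∀ z ∈ S, f z ∈ S.filter fun z => f z = z := fun z hz =>
    mem_filter.2 ⟨hS z hz _ (hf z), (hf' _ _ (hf z)).symm⟩
  rw [card_eq_sum_card_fiberwise h1, Nat.cast_sum, card_eq_sum_ones, Nat.cast_sum]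
  refine sum_congr rfl fun b hb => ?_
  rw [Nat.cast_one, ← hs b]
  congr 2
  ext z
  simp only [mem_filter, mem_univ, true_and] at hb ⊢
  constructor
  · rintro ⟨_, rfl⟩
    exact s.symm' (hf z)
  · intro h
    exact ⟨hS b hb.1 z h, by rw [← hf' b z h, hb.2]⟩

theorem exists_max_rep (s : Setoid α) : ∃ f : α → α, (∀ z, s z (f z)) ∧
    (∀ z w, s z w → f z = f w) ∧ ∀ z, f z = z ↔ ∀ w, s z w → w ≤ z := by
  choose f hf hf' using fun z => exists_max (P := fun w => s z w) ⟨z, s.refl' z⟩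
  have h1 : ∀ z w, s z w → f z = f w := fun z w h => le_antisymm
    (hf' w _ (s.trans' (s.symm' h) (hf z))) (hf' z _ (s.trans' h (hf w)))
  refine ⟨f, hf, h1, fun z => ⟨fun h w hw => h ▸ hf' z w hw, fun h => ?_⟩⟩
  exact le_antisymm (h _ (hf z)) (hf' z _ (s.refl' z))

theorem exists_min_rep (s : Setoid α) : ∃ f : α → α, (∀ z, s z (f z)) ∧
    (∀ z w, s z w → f z = f w) ∧ ∀ z, f z = z ↔ ∀ w, s z w → z ≤ w :=
  exists_max_rep (α := αᵒᵈ) s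

open Classical in
/-- The interval spanned by a class consists of the class and its gaps. -/
theorem card_span {s : Setoid α} (hs : ClassesOne d s) (hg : GapsZero d s) {m p : α} (h : s m p)
    (hm : ∀ x, s m x → m ≤ x) (hp : ∀ x, s m x → x ≤ p) :
    ((univ.filter fun z => m ≤ z ∧ z ≤ p).card : ZMod d) = 1 := by
  have : (univ.filter fun z => m ≤ z ∧ z ≤ p) = (univ.filter fun z => s m z) ∪
      univ.filter fun z => m < z ∧ z < p ∧ ¬ s m z := by
    ext z
    simp only [mem_filter, mem_univ, true_and, mem_union]
    constructor
    · rintro ⟨h1, h2⟩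
      by_cases hz : s m z
      · exact Or.inl hz
      · refine Or.inr ⟨lt_of_le_of_ne h1 ?_, lt_of_le_of_ne h2 ?_, hz⟩
        · rintro rfl; exact hz (s.refl' _)
        · rintro rfl; exact hz h
    · rintro (hz | ⟨h1, h2, -⟩)
      · exact ⟨hm z hz, hp z hz⟩
      · exact ⟨h1.le, h2.le⟩
  rw [this, card_union_of_disjoint, Nat.cast_add, hs m, hg m p h, add_zero]
  rw [disjoint_filter]
  tauto

end

variable {d : ℕ}

/-- For `x < y` in one class, `[x, y)` is a union of dual classes and the gap is a union of classes.
So modulo `d`, the size of `[x, y)` is the number of minima of dual classes in it, and the size of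
the gap is the number of maxima of classes in it. These maxima are exactly the points of `[x, y)`
that are not minima of dual classes, and their number is therefore divisible by `d`. -/
theorem gapsZero_of_classesOne {s : Setoid (Fin n)} (hs : IsNoncr s) (h : ClassesOne d s)
    (hk : ClassesOne d (kr s)) : GapsZero d s := by
  classical
  intro x y hxy
  by_cases hlt : x < y
  swap
  · rw [filter_false_of_mem, card_empty, Nat.cast_zero]
    rintro z - ⟨h1, h2, -⟩
    exact hlt (h1.trans h2)
  obtain ⟨f, hf, hf', hfm⟩ := exists_max_rep s
  obtain ⟨g, hg, hg', hgm⟩ := exists_min_rep (kr s)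
  have hsat : ∀ z ∈ univ.filter (fun z => x < z ∧ z < y ∧ ¬ s x z), ∀ w, s z w →
      w ∈ univ.filter (fun z => x < z ∧ z < y ∧ ¬ s x z) := by
    intro z hz w hzw
    simp only [mem_filter, mem_univ, true_and] at hz ⊢
    obtain ⟨h1, h2, h3⟩ := hz
    have hw : ¬ s x w := fun hw => h3 (s.trans' hw (s.symm' hzw))
    have hwx : w ≠ x := by rintro rfl; exact hw (s.refl' _)
    have hwy : w ≠ y := by rintro rfl; exact hw hxy
    have h4 : ¬ w < x := fun hv => hw (s.symm' (hs w x z y hv h1 h2 (s.symm' hzw) hxy))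
    have h5 : ¬ y < w := fun hv => h3 (hs x z y w h1 h2 hv hxy hzw)
    exact ⟨by omega, by omega, hw⟩
  have h1 := card_eq_card_fixed hg hg' hk (univ.filter fun z => x ≤ z ∧ z < y) (by
    intro z hz w hzw
    simp only [mem_filter, mem_univ, true_and] at hz ⊢
    exact kr_between hxy hlt hzw hz)
  have h2 := card_eq_card_fixed hf hf' h _ hsat
  -- If `z` is the maximum of a class in the gap and `m` is its minimum, then `m - 1` is dual to `z`
  -- and smaller. Conversely, a smaller `p` dual to `z` confines the class of `z` to `(p, z]`, so
  -- that `z` is its maximum.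
  have h3 : (univ.filter fun z => x < z ∧ z < y ∧ ¬ s x z).filter (fun z => f z = z) =
      (univ.filter fun z => x ≤ z ∧ z < y).filter (fun z => ¬ g z = z) := by
    ext z
    constructor
    · intro hz
      rw [mem_filter, hfm] at hz
      obtain ⟨m, hm, hmm⟩ := exists_min (P := fun w => s z w) ⟨z, s.refl' z⟩
      have hm' := hsat z hz.1 m hm
      simp only [mem_filter, mem_univ, true_and] at hz hm' ⊢
      refine ⟨⟨hz.1.1.le, hz.1.2.1⟩, fun h => ?_⟩
      have hk := kr_pred_max hs (q := ⟨m.val - 1, by omega⟩) (s.symm' hm)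
        (fun w hw => hmm w (s.trans' hm hw)) (fun w hw => hz.2 w (s.trans' hm hw))
        (by have := hm'.1; simp only; omega)
      have h4 := (hgm z).1 h _ ((kr s).symm' hk)
      have h5 := hmm z (s.refl' z)
      have := hm'.1
      rw [Fin.le_def] at h4
      simp only at h4
      omega
    · intro hz
      simp only [mem_filter, mem_univ, true_and, hgm, hfm] at hz ⊢
      obtain ⟨⟨h1, h2⟩, h3⟩ := hz
      push Not at h3
      obtain ⟨p, hp, hpz⟩ := h3
      have h4 : ∀ w, s z w → w ≤ z := fun w hw => (kr_lt ((kr s).symm' hp) hw hpz le_rfl).2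
      have h5 : ¬ s x z := fun hxz => absurd (h4 y (s.trans' (s.symm' hxz) hxy)) (not_le.2 h2)
      refine ⟨⟨lt_of_le_of_ne h1 ?_, h2, h5⟩, h4⟩
      rintro rfl
      exact h5 (s.refl' _)
  rw [h2, h3]
  have h4 := card_filter_add_card_filter_not (s := univ.filter fun z => x ≤ z ∧ z < y)
    (fun z => g z = z)
  rw [← h4, Nat.cast_add] at h1
  simpa using h1

-- If `p` has a successor `y` in its class, then `q = y - 1` and the interval is a gap. Otherwise
-- `p` is the maximum of its class. If the class starts at the first point, then `q` is the last
-- point and the interval is the complement of the span of the class, of size `1 - 1` modulo `d`. If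
-- it starts later, then the point before its minimum contradicts the minimality of `p`.
open Classical in
theorem card_class_span {s : Setoid (Fin n)} (hs : IsNoncr s) (hn : (n : ZMod d) = 1)
    (h : ClassesOne d s) (hg : GapsZero d s) {p q : Fin n} (hpq : kr s p q)
    (hp : ∀ x, kr s p x → p ≤ x) (hq : ∀ x, kr s p x → x ≤ q) :
    ((univ.filter fun z => p < z ∧ z ≤ q).card : ZMod d) = 0 := by
  by_cases hy : ∃ y, p < y ∧ s p y
  · obtain ⟨y, ⟨hpy, hy⟩, hym⟩ := exists_min hy
    have hgap : ∀ u, p < u → u < y → ¬ s p u := fun u hu huy h =>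
      absurd (hym u ⟨hu, h⟩) (not_le.2 huy)
    have h1 := hq _ (kr_gap hs (q := ⟨y.val - 1, by omega⟩) hpy hy hgap (by simp only; omega))
    have h2 := (kr_between hy hpy hpq ⟨le_rfl, hpy⟩).2
    rw [← hg p y hy]
    congr 2
    ext z
    simp only [mem_filter, mem_univ, true_and]
    rw [Fin.le_def] at h1
    simp only at h1
    constructor
    · rintro ⟨h3, h4⟩
      exact ⟨h3, by omega, hgap z h3 (by omega)⟩
    · rintro ⟨h3, h4, -⟩
      exact ⟨h3, by omega⟩
  · push Not at hy
    obtain ⟨m, hm, hmm⟩ := exists_min (P := fun w => s p w) ⟨p, s.refl' p⟩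
    have h1 : ∀ x, s m x → m ≤ x := fun x hx => hmm x (s.trans' hm hx)
    have h2 : ∀ x, s m x → x ≤ p := fun x hx => by
      by_contra hlt
      exact hy x (not_le.1 hlt) (s.trans' hm hx)
    have hmp := h1 p (s.symm' hm)
    by_cases hm0 : m.val = 0
    · have h3 := hq _ (kr_last hs (q := ⟨n - 1, by omega⟩) (s.symm' hm) hm0 h2
        (by simp only; omega))
      rw [Fin.le_def] at h3
      simp only at h3
      have h4 := card_span h hg (s.symm' hm) h1 h2
      have h5 := card_filter_add_card_filter_not (s := (univ : Finset (Fin n)))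
        (fun z => m ≤ z ∧ z ≤ p)
      rw [card_univ, Fintype.card_fin] at h5
      have h6 := congrArg (Nat.cast : ℕ → ZMod d) h5
      rw [Nat.cast_add, h4, hn] at h6
      rw [← add_left_cancel (h6.trans (add_zero (1 : ZMod d)).symm)]
      congr 2
      ext z
      simp only [mem_filter, mem_univ, true_and]
      omega
    · have h3 := hp _ ((kr s).symm' (kr_pred_max hs (q := ⟨m.val - 1, by omega⟩) (s.symm' hm) h1 h2
        (by simp only; omega)))
      rw [Fin.le_def] at h3
      simp only at h3
      omega

/-- The elements of a dual class cut the interval from its minimum `p` (excluded) to its maximum `q`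
into segments. The segment ending at `c` is the span of the class with maximum `c`, so its size is
`1` modulo `d`. As the whole interval has size `0`, the number of elements other than `p` is `0`
modulo `d`. -/
theorem classesOne_kr {s : Setoid (Fin n)} (hs : IsNoncr s) (hn : (n : ZMod d) = 1)
    (h : ClassesOne d s) (hg : GapsZero d s) : ClassesOne d (kr s) := by
  classical
  intro x
  obtain ⟨p, hp, hpm⟩ := exists_min (P := fun w => kr s x w) ⟨x, (kr s).refl' x⟩
  obtain ⟨q, hq, hqm⟩ := exists_max (P := fun w => kr s x w) ⟨x, (kr s).refl' x⟩
  have h0 := card_class_span hs hn h hg ((kr s).trans' ((kr s).symm' hp) hq)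
    (fun w hw => hpm w ((kr s).trans' hp hw)) (fun w hw => hqm w ((kr s).trans' hp hw))
  have hex : ∀ z, z ≤ q → ∃ c, (kr s x c ∧ z ≤ c) ∧ ∀ c', kr s x c' ∧ z ≤ c' → c ≤ c' :=
    fun z hz => exists_min ⟨q, hq, hz⟩
  -- `f z` is the first element of the dual class at or after `z`; the fibres of `f` are the
  -- segments.
  choose! f hf hfm using hex
  set C := univ.filter fun z => kr s x z with hC
  have hpC : p ∈ C := by simpa [hC] using hp
  have h1 : ∀ z ∈ univ.filter (fun z => p < z ∧ z ≤ q), f z ∈ C.erase p := by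
    intro z hz
    simp only [mem_filter, mem_univ, true_and] at hz
    have := hf z hz.2
    simp only [hC, mem_erase, mem_filter, mem_univ, true_and]
    exact ⟨by rintro h; omega, this.1⟩
  rw [card_eq_sum_card_fiberwise h1, Nat.cast_sum] at h0
  have h2 : ∀ c ∈ C.erase p,
      (((univ.filter (fun z => p < z ∧ z ≤ q)).filter fun z => f z = c).card : ZMod d) = 1 := by
    intro c hc
    simp only [hC, mem_erase, mem_filter, mem_univ, true_and] at hc
    have hpc : p < c := lt_of_le_of_ne (hpm c hc.2) (Ne.symm hc.1)
    have hk : kr s p c := (kr s).trans' ((kr s).symm' hp) hc.2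
    obtain ⟨m, hm, hmm⟩ := exists_min (P := fun w => s c w) ⟨c, s.refl' c⟩
    have h3 : ∀ w, s m w → p < w ∧ w ≤ c := fun w hw => kr_lt hk (s.trans' hm hw) hpc le_rfl
    have hmc := s.symm' hm
    have h4 : ∀ w, s m w → m ≤ w := fun w hw => hmm w (s.trans' hm hw)
    have hpm' := (h3 m (s.refl' m)).1
    have h5 : kr s ⟨m.val - 1, by omega⟩ c :=
      kr_pred_max hs hmc h4 (fun w hw => (h3 w hw).2) (by simp only; omega)
    rw [← card_span h hg hmc h4 fun w hw => (h3 w hw).2]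
    congr 2
    ext z
    have hcq := hqm c hc.2
    simp only [mem_filter, mem_univ, true_and]
    constructor
    · rintro ⟨⟨h6, h7⟩, rfl⟩
      refine ⟨?_, (hf z h7).2⟩
      by_contra hlt
      have h8 := hfm z h7 ⟨m.val - 1, by omega⟩ ⟨(kr s).trans' hc.2 ((kr s).symm' h5), by
        rw [Fin.le_def]; simp only; omega⟩
      have h9 := (h3 m (s.refl' m)).2
      rw [Fin.le_def] at h8
      simp only at h8
      omega
    · rintro ⟨h6, h7⟩
      have hzq : z ≤ q := by omega
      refine ⟨⟨by omega, hzq⟩, ?_⟩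
      have h8 := hfm z hzq c ⟨hc.2, h7⟩
      have h9 := hf z hzq
      by_contra hne
      have h10 := kr_between hmc (show m < c by omega)
        ((kr s).trans' ((kr s).symm' h9.1) hc.2) (by omega)
      omega
  rw [sum_congr rfl h2, sum_const, nsmul_eq_mul, mul_one] at h0
  rw [← card_erase_add_one hpC, Nat.cast_add, h0, zero_add, Nat.cast_one]

end Noncrossing

/-! ## Products of posets in the Hopf algebra -/

namespace PosetHopf

/-- A product over `Option ι` splits off one factor. -/
def piOptionIso {ι : Type} (X : Option ι → Type) [∀ i, PartialOrder (X i)] :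
    (∀ i, X i) ≃o X none × ∀ i, X (some i) where
  toEquiv := Equiv.piOptionEquivProd
  map_rel_iff' := by
    intro f g
    simp only [Equiv.piOptionEquivProd, Equiv.coe_fn_mk, Prod.le_def, Pi.le_def, Option.forall]

/-- Reindexing a product. -/
def piReindexIso {ι κ : Type} (e : ι ≃ κ) (X : κ → Type) [∀ i, PartialOrder (X i)] :
    (∀ i, X (e i)) ≃o ∀ i, X i where
  toEquiv := Equiv.piCongrLeft X e
  map_rel_iff' := by
    intro f g
    simp only [Pi.le_def]
    rw [← e.forall_congr_right]
    simp

/-- Isomorphisms of the factors give an isomorphism of the products. -/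
def piCongrIso {ι : Type} {X Y : ι → Type} [∀ i, PartialOrder (X i)] [∀ i, PartialOrder (Y i)]
    (e : ∀ i, X i ≃o Y i) : (∀ i, X i) ≃o ∀ i, Y i where
  toEquiv := Equiv.piCongrRight fun i => (e i).toEquiv
  map_rel_iff' := by
    intro f g
    simp [Pi.le_def]

/-- The dual of a product is the product of the duals. -/
def piDualIso {ι : Type} (X : ι → Type) [∀ i, PartialOrder (X i)] :
    (∀ i, X i)ᵒᵈ ≃o ∀ i, (X i)ᵒᵈ where
  toFun f i := OrderDual.toDual (OrderDual.ofDual f i)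
  invFun f := OrderDual.toDual fun i => OrderDual.ofDual (f i)
  left_inv _ := rfl
  right_inv _ := rfl
  map_rel_iff' := Iff.rfl

variable (R : Type*) [CommRing R]

theorem of_pi {ι : Type} [Fintype ι] (X : ι → Type) [∀ i, PartialOrder (X i)]
    [∀ i, BoundedOrder (X i)] [∀ i, Finite (X i)] : of R (∀ i, X i) = ∏ i, of R (X i) := by
  revert X
  refine Fintype.induction_empty_option (P := fun ι _ => ∀ (X : ι → Type) [∀ i, PartialOrder (X i)]
    [∀ i, BoundedOrder (X i)] [∀ i, Finite (X i)], of R (∀ i, X i) = ∏ i, of R (X i))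
    ?_ ?_ ?_ ι
  · intro α β _ e ih X _ _ _
    let _ := Fintype.ofEquiv β e.symm
    rw [← of_eq_of_iso (piReindexIso e X), ih]
    exact Fintype.prod_equiv e _ _ fun _ => rfl
  · intro X _ _ _
    simp [of_eq_one]
  · intro α _ ih X _ _ _
    rw [of_eq_of_iso (piOptionIso X), ← of_mul_of, ih, Fintype.prod_option]

end PosetHopf

/-! ## Intervals of noncrossing partitions -/

namespace Noncrossing

open Finset

/-- The equivalence relation of a partition. -/
def rel {n : ℕ} (π : Finpartition (univ : Finset (Fin n))) : Setoid (Fin n) := Setoid.ker π.part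

section

variable {n d : ℕ}

theorem rel_iff_mem {π : Finpartition (univ : Finset (Fin n))} {a b : Fin n} :
    rel π a b ↔ b ∈ π.part a := by
  rw [π.mem_part_iff_part_eq_part (mem_univ _) (mem_univ _)]
  exact eq_comm

theorem rel_iff {π : Finpartition (univ : Finset (Fin n))} {a b : Fin n} :
    rel π a b ↔ ∃ B ∈ π.parts, a ∈ B ∧ b ∈ B := by
  rw [rel_iff_mem, Finpartition.mem_part_iff_exists]
  simp only [and_comm]

theorem rel_of_mem {π : Finpartition (univ : Finset (Fin n))} {B : Finset (Fin n)}
    (hB : B ∈ π.parts) {a b : Fin n} (ha : a ∈ B) : rel π a b ↔ b ∈ B := by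
  rw [rel_iff_mem, π.part_eq_of_mem hB ha]

theorem part_mem_parts (π : Finpartition (univ : Finset (Fin n))) (a : Fin n) :
    π.part a ∈ π.parts := π.part_mem.2 (mem_univ a)

theorem mem_part (π : Finpartition (univ : Finset (Fin n))) (a : Fin n) : a ∈ π.part a :=
  π.mem_part_self.2 (mem_univ a)

theorem rel_le_rel {π σ : Finpartition (univ : Finset (Fin n))} :
    rel π ≤ rel σ ↔ ∀ B ∈ π.parts, ∃ C ∈ σ.parts, B ⊆ C := by
  constructor
  · intro h B hB
    obtain ⟨a, ha⟩ := π.nonempty_of_mem_parts hB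
    exact ⟨σ.part a, part_mem_parts σ a, fun b hb =>
      rel_iff_mem.1 (h ((rel_of_mem hB ha).2 hb))⟩
  · intro h a b hab
    obtain ⟨B, hB, ha, hb⟩ := rel_iff.1 hab
    obtain ⟨C, hC, hBC⟩ := h B hB
    exact rel_iff.2 ⟨C, hC, hBC ha, hBC hb⟩

theorem isNoncr_rel {π : Finpartition (univ : Finset (Fin n))} :
    IsNoncr (rel π) ↔ IsNoncrossing π.parts := by
  constructor
  · rintro h B hB C hC hne ⟨i, j, k, l, hij, hjk, hkl, hi, hk, hj, hl⟩
    have := h i j k l hij hjk hkl ((rel_of_mem hB hi).2 hk) ((rel_of_mem hC hj).2 hl)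
    exact hne (π.eq_of_mem_parts hB hC ((rel_of_mem hB hi).1 this) hj)
  · intro h i j k l hij hjk hkl hik hjl
    obtain ⟨B, hB, hi, hk⟩ := rel_iff.1 hik
    obtain ⟨C, hC, hj, hl⟩ := rel_iff.1 hjl
    by_contra hne
    refine h B hB C hC ?_ ⟨i, j, k, l, hij, hjk, hkl, hi, hk, hj, hl⟩
    rintro rfl
    exact hne ((rel_of_mem hB hi).2 hj)

theorem classesOne_rel {π : Finpartition (univ : Finset (Fin n))} :
    ClassesOne d (rel π) ↔ ∀ B ∈ π.parts, B.card ≡ 1 [MOD d] := by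
  classical
  have key : ∀ a, (univ.filter fun z => rel π a z) = π.part a := fun a => by
    ext z
    simp [rel_iff_mem]
  simp only [← ZMod.natCast_eq_natCast_iff, Nat.cast_one]
  constructor
  · intro h B hB
    obtain ⟨a, ha⟩ := π.nonempty_of_mem_parts hB
    rw [← π.part_eq_of_mem hB ha, ← key, ← h a]
  · intro h a
    rw [← h _ (part_mem_parts π a), ← key]

theorem rel_ofSetoid (s : Setoid (Fin n)) [DecidableRel s.r] :
    rel (Finpartition.ofSetoid s) = s := by
  ext a b
  rw [rel_iff_mem, Finpartition.mem_part_ofSetoid_iff_rel]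

theorem rel_krewerasDual (π : Finpartition (univ : Finset (Fin n))) :
    rel (krewerasDual π) = kr (rel π) := by
  rw [krewerasDual, rel_ofSetoid]
  ext i j
  constructor
  · intro h a b hab
    obtain ⟨B, hB, ha, hb⟩ := rel_iff.1 hab
    rcases h B hB with g | g
    · exact iff_of_true (g a ha) (g b hb)
    · exact iff_of_false (g a ha) (g b hb)
  · intro h B hB
    obtain ⟨a, ha⟩ := π.nonempty_of_mem_parts hB
    by_cases hs : (a ≤ i ↔ a ≤ j)
    · exact Or.inl fun b hb => (h a b ((rel_of_mem hB ha).2 hb)).1 hs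
    · exact Or.inr fun b hb hs' => hs ((h a b ((rel_of_mem hB ha).2 hb)).2 hs')

theorem isIndivisible_iff {π : Finpartition (univ : Finset (Fin n))} :
    IsIndivisible d π ↔ ClassesOne d (rel π) ∧ ClassesOne d (kr (rel π)) := by
  rw [← rel_krewerasDual, classesOne_rel, classesOne_rel]
  rfl

theorem parts_eq_of_rel_eq {π σ : Finpartition (univ : Finset (Fin n))} (h : rel π = rel σ) :
    π = σ :=
  le_antisymm (rel_le_rel.1 h.le) (rel_le_rel.1 h.ge)

end

/-! ### The gap condition on arbitrary finite linear orders, and its restriction to blocks -/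

/-- The property that defines indivisible noncrossing partitions, for any finite linear order. -/
def IsNCGap (d : ℕ) {α : Type} [LinearOrder α] [Fintype α] (s : Setoid α) : Prop :=
  IsNoncr s ∧ ClassesOne d s ∧ GapsZero d s

/-- The indivisible noncrossing partitions of a finite linear order, as equivalence relations. -/
abbrev NCGap (d : ℕ) (α : Type) [LinearOrder α] [Fintype α] : Type :=
  {s : Setoid α // IsNCGap d s}

section

variable {d : ℕ} {α β : Type} [LinearOrder α] [Fintype α] [LinearOrder β] [Fintype β]

theorem IsNCGap.comap (e : α ≃o β) {s : Setoid β} (h : IsNCGap d s) :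
    IsNCGap d (s.comap e) := by
  classical
  obtain ⟨h1, h2, h3⟩ := h
  refine ⟨?_, ?_, ?_⟩
  · intro i j k l hij hjk hkl
    exact h1 _ _ _ _ (e.lt_iff_lt.2 hij) (e.lt_iff_lt.2 hjk) (e.lt_iff_lt.2 hkl)
  · intro x
    rw [← h2 (e x)]
    congr 1
    exact card_equiv e.toEquiv (by simp [Setoid.comap_rel])
  · intro x y hxy
    rw [← h3 (e x) (e y) hxy]
    congr 1
    exact card_equiv e.toEquiv (by simp [Setoid.comap_rel])

/-- Isomorphic linear orders have isomorphic posets of indivisible noncrossing partitions. -/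
def NCGap.congr (e : α ≃o β) : NCGap d β ≃o NCGap d α where
  toFun s := ⟨s.1.comap e, s.2.comap e⟩
  invFun s := ⟨s.1.comap e.symm, s.2.comap e.symm⟩
  left_inv s := by
    ext x y
    simp [Setoid.comap_rel]
  right_inv s := by
    ext x y
    simp [Setoid.comap_rel]
  map_rel_iff' := by
    intro s t
    change (∀ {x y}, s.1 (e x) (e y) → t.1 (e x) (e y)) ↔ ∀ {x y}, s.1 x y → t.1 x y
    refine ⟨fun h x y hxy => ?_, fun h x y => h⟩
    have := h (x := e.symm x) (y := e.symm y)
    simpa using this (by simpa using hxy)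

variable {ι : Type} {S : ι → Finset α} {s : Setoid α}

/-- An equivalence relation finer than an indivisible noncrossing partition is an indivisible
noncrossing partition if and only if its restrictions to the blocks are. -/
theorem isNCGap_iff_restrict (hS : ∀ x, ∃ i, x ∈ S i)
    (hs : ∀ i, ∀ x ∈ S i, ∀ y, s x y ↔ y ∈ S i) (h : IsNCGap d s) {t : Setoid α} (ht : t ≤ s) :
    IsNCGap d t ↔ ∀ i, IsNCGap d (t.comap (Subtype.val : S i → α)) := by
  classical
  obtain ⟨h1, h2, h3⟩ := h
  have hc : ∀ i (x : S i), ((univ.filter fun z : S i => t x z).card : ZMod d) =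
      (univ.filter fun z => t x.1 z).card := fun i x => by
    rw [← card_map (Function.Embedding.subtype _)]
    congr 2
    ext z
    simp only [mem_map, mem_filter, mem_univ, true_and, Function.Embedding.subtype_apply,
      Subtype.exists, exists_and_left, exists_prop, exists_eq_right_right, and_iff_left_iff_imp]
    exact fun hz => (hs i x x.2 z).1 (ht hz)
  have hg : ∀ i (x y : S i), ((univ.filter fun z : S i => x < z ∧ z < y ∧ ¬ t x z).card : ZMod d) =
      (univ.filter fun z => x.1 < z ∧ z < y.1 ∧ ¬ t x.1 z).card := fun i x y => by
    -- A gap of `t` consists of the points outside the block of `s`, which form a gap of `s` and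
    -- number `0` modulo `d`, and of the gap of `t` inside the block.
    have e1 : (univ.filter fun z => x.1 < z ∧ z < y.1 ∧ ¬ t x.1 z) =
        (univ.filter fun z => x.1 < z ∧ z < y.1 ∧ ¬ s x.1 z) ∪
        (univ.filter fun z : S i => x < z ∧ z < y ∧ ¬ t x z).map
          (Function.Embedding.subtype _) := by
      ext z
      simp only [mem_map, mem_filter, mem_univ, true_and, Function.Embedding.subtype_apply,
        Subtype.exists, mem_union, ← Subtype.coe_lt_coe, exists_and_right, exists_eq_right]
      rw [hs i x x.2]
      have : t x z → z ∈ S i := fun hz => (hs i x x.2 z).1 (ht hz)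
      by_cases hz : z ∈ S i
      · simp [hz]
      · simp only [hz, IsEmpty.exists_iff]
        tauto
    rw [e1, card_union_of_disjoint, Nat.cast_add, h3 x y ((hs i x x.2 y).2 y.2), zero_add,
      card_map]
    rw [Finset.disjoint_left]
    intro z hz hz'
    simp only [mem_filter, mem_univ, true_and, mem_map, Function.Embedding.subtype_apply,
      hs i x x.2] at hz hz'
    obtain ⟨w, -, rfl⟩ := hz'
    exact hz.2.2 w.2
  constructor
  · rintro ⟨t1, t2, t3⟩ i
    refine ⟨fun a b c e hab hbc hce => t1 a b c e hab hbc hce, fun x => ?_, fun x y hxy => ?_⟩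
    · rw [← t2 x, ← hc]
      congr!
    · rw [← t3 x y hxy, ← hg]
      congr!
  · intro hi
    refine ⟨?_, ?_, ?_⟩
    · intro a b c e hab hbc hce hac hbe
      obtain ⟨i, ha⟩ := hS a
      have hb := (hs i a ha b).1 (h1 a b c e hab hbc hce (ht hac) (ht hbe))
      have hc := (hs i a ha c).1 (ht hac)
      have he := (hs i b hb e).1 (ht hbe)
      exact (hi i).1 ⟨a, ha⟩ ⟨b, hb⟩ ⟨c, hc⟩ ⟨e, he⟩ hab hbc hce hac hbe
    · intro x
      obtain ⟨i, hx⟩ := hS x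
      refine ((hc i ⟨x, hx⟩).symm.trans ?_)
      rw [← (hi i).2.1 ⟨x, hx⟩]
      congr!
    · intro x y hxy
      obtain ⟨i, hx⟩ := hS x
      have hy := (hs i x hx y).1 (ht hxy)
      refine ((hg i ⟨x, hx⟩ ⟨y, hy⟩).symm.trans ?_)
      rw [← (hi i).2.2 ⟨x, hx⟩ ⟨y, hy⟩ hxy]
      congr!

/-- The disjoint union of equivalence relations on the blocks of a partition. -/
def glue (hS : ∀ x, ∃ i, x ∈ S i) (hs : ∀ i j x, x ∈ S i → x ∈ S j → i = j)
    (u : ∀ i, Setoid (S i)) : Setoid α where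
  r x y := ∃ i, ∃ hx : x ∈ S i, ∃ hy : y ∈ S i, u i ⟨x, hx⟩ ⟨y, hy⟩
  iseqv :=
    { refl := fun x => by
        obtain ⟨i, hi⟩ := hS x
        exact ⟨i, hi, hi, (u i).refl' _⟩
      symm := fun ⟨i, hx, hy, h⟩ => ⟨i, hy, hx, (u i).symm' h⟩
      trans := by
        rintro x y z ⟨i, hx, hy, h⟩ ⟨j, hy', hz, h'⟩
        obtain rfl := hs i j y hy hy'
        exact ⟨i, hx, hz, (u i).trans' h h'⟩ }

/-- The partitions that refine a given one are given by partitions of its blocks. -/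
theorem exists_iicIso (hS : ∀ x, ∃ i, x ∈ S i) (hS' : ∀ i j x, x ∈ S i → x ∈ S j → i = j)
    (s : NCGap d α) (hs : ∀ i, ∀ x ∈ S i, ∀ y, s.1 x y ↔ y ∈ S i) :
    Nonempty (Set.Iic s ≃o ∀ i, NCGap d (S i)) := by
  let f : Set.Iic s → ∀ i, NCGap d (S i) := fun t i =>
    ⟨t.1.1.comap Subtype.val, (isNCGap_iff_restrict hS hs s.2 t.2).1 t.1.2 i⟩
  have hf : ∀ t t', f t ≤ f t' ↔ t ≤ t' := by
    intro t t'
    constructor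
    · intro h x y hxy
      obtain ⟨i, hx⟩ := hS x
      have hy := (hs i x hx y).1 (t.2 hxy)
      exact h i (x := ⟨x, hx⟩) (y := ⟨y, hy⟩) hxy
    · intro h i x y hxy
      exact h hxy
  refine ⟨RelIso.ofSurjective (OrderEmbedding.ofMapLEIff f hf) fun u => ?_⟩
  let t : Setoid α := glue hS hS' fun i => (u i).1
  have ht : t ≤ s.1 := by
    rintro x y ⟨i, hx, hy, -⟩
    exact (hs i x hx y).2 hy
  have htu : ∀ i, t.comap (Subtype.val : S i → α) = (u i).1 := by
    intro i
    ext x y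
    constructor
    · rintro ⟨j, hx, hy, h⟩
      obtain rfl := hS' i j x x.2 hx
      exact h
    · intro h
      exact ⟨i, x.2, y.2, h⟩
  refine ⟨⟨⟨t, (isNCGap_iff_restrict hS hs s.2 ht).2 fun i => ?_⟩, ht⟩, ?_⟩
  · rw [htu]
    exact (u i).2
  · funext i
    exact Subtype.ext (htu i)

end

/-! ### Lower and upper intervals of `NC d n` as products -/

variable {n d : ℕ}

theorem cast_eq_one (h : n ≡ 1 [MOD d]) : (n : ZMod d) = 1 := by
  have := (ZMod.natCast_eq_natCast_iff n 1 d).2 h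
  simpa using this

theorem isNCGap_rel (h : n ≡ 1 [MOD d]) {π : Finpartition (univ : Finset (Fin n))} :
    IsNCGap d (rel π) ↔ IsNoncrossing π.parts ∧ IsIndivisible d π := by
  rw [isIndivisible_iff, ← isNoncr_rel]
  constructor
  · rintro ⟨h1, h2, h3⟩
    exact ⟨h1, h2, classesOne_kr h1 (cast_eq_one h) h2 h3⟩
  · rintro ⟨h1, h2, h3⟩
    exact ⟨h1, h2, gapsZero_of_classesOne h1 h2 h3⟩

/-- Indivisible noncrossing partitions as equivalence relations. -/
noncomputable def ncIso (h : n ≡ 1 [MOD d]) : NC d n ≃o NCGap d (Fin n) :=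
  RelIso.ofSurjective
    (OrderEmbedding.ofMapLEIff (fun π => ⟨rel π.1, (isNCGap_rel h).2 π.2⟩) fun _ _ => rel_le_rel)
    fun s => by
      classical
      exact ⟨⟨Finpartition.ofSetoid s.1, (isNCGap_rel h).1 (by rw [rel_ofSetoid]; exact s.2)⟩,
        Subtype.ext (rel_ofSetoid s.1)⟩

theorem exists_nc_iicIso (h : n ≡ 1 [MOD d]) (π : NC d n) :
    Nonempty (Set.Iic π ≃o ∀ B : π.1.parts, NC d B.1.card) := by
  obtain ⟨e⟩ := exists_iicIso (S := fun B : π.1.parts => B.1)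
    (fun x => ⟨⟨_, part_mem_parts π.1 x⟩, mem_part π.1 x⟩)
    (fun B C x hB hC => Subtype.ext (π.1.eq_of_mem_parts B.2 C.2 hB hC))
    (ncIso h π) (fun B x hx y => rel_of_mem B.2 hx)
  exact ⟨((PosetHopf.iicCongr (ncIso h) π).trans e).trans (PosetHopf.piCongrIso fun B =>
    (NCGap.congr (B.1.orderIsoOfFin rfl)).trans (ncIso (π.2.2.1 B.1 B.2)).symm)⟩

theorem classesOne_kr_kr {s : Setoid (Fin n)} (hs : IsNoncr s) (h : ClassesOne d s) :
    ClassesOne d (kr (kr s)) := by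
  classical
  intro x
  cases n with
  | zero => exact x.elim0
  | succ n =>
    rw [← h (x + 1)]
    congr 1
    exact card_equiv (Equiv.addRight (1 : Fin (n + 1))) (by simp [kr_kr hs])

theorem krewerasDual_mem (π : NC d n) :
    IsNoncrossing (krewerasDual π.1).parts ∧ IsIndivisible d (krewerasDual π.1) := by
  obtain ⟨h1, h2⟩ := π.2
  rw [← isNoncr_rel] at h1
  rw [isIndivisible_iff] at h2
  rw [← isNoncr_rel, isIndivisible_iff, rel_krewerasDual]
  exact ⟨isNoncr_kr _, h2.2, classesOne_kr_kr h1 h2.1⟩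

/-- The Kreweras dual as an order reversing bijection. -/
noncomputable def krIso (d n : ℕ) : NC d n ≃o (NC d n)ᵒᵈ :=
  let f : NC d n ↪o (NC d n)ᵒᵈ := OrderEmbedding.ofMapLEIff
    (fun π => OrderDual.toDual ⟨krewerasDual π.1, krewerasDual_mem π⟩) fun π σ => by
      refine (rel_le_rel.symm.trans ?_).trans rel_le_rel
      change rel (krewerasDual σ.1) ≤ rel (krewerasDual π.1) ↔ _
      rw [rel_krewerasDual, rel_krewerasDual]
      exact ⟨le_of_kr_le (isNoncr_rel.2 σ.2.1), kr_antitone⟩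
  RelIso.ofSurjective f
    (Finite.surjective_of_injective (f := fun π => OrderDual.ofDual (f π)) f.injective)

/-- An upper interval of the dual order is the dual of a lower interval. -/
def iciDual {α : Type} [PartialOrder α] (x : αᵒᵈ) :
    Set.Ici x ≃o (Set.Iic (OrderDual.ofDual x))ᵒᵈ where
  toFun z := OrderDual.toDual ⟨OrderDual.ofDual z.1, z.2⟩
  invFun z := ⟨OrderDual.toDual (OrderDual.ofDual z).1, (OrderDual.ofDual z).2⟩
  left_inv _ := rfl
  right_inv _ := rfl
  map_rel_iff' := Iff.rfl

/-- The Kreweras dual turns the upper interval of `π` into the opposite of the lower interval of the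
dual of `π`. The factors of the latter are self-dual by `krIso` again, which removes the opposite
orders. -/
theorem exists_nc_iciIso (h : n ≡ 1 [MOD d]) (π : NC d n) :
    Nonempty (Set.Ici π ≃o ∀ C : (krewerasDual π.1).parts, NC d C.1.card) := by
  obtain ⟨e⟩ := exists_nc_iicIso h (⟨krewerasDual π.1, krewerasDual_mem π⟩ : NC d n)
  exact ⟨(((PosetHopf.iciCongr (krIso d n) π).trans (iciDual _)).trans e.dual).trans
    ((PosetHopf.piDualIso _).trans (PosetHopf.piCongrIso fun C => (krIso d _).symm))⟩

section

variable (R : Type*) [CommRing R]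

theorem of_Iic (h : n ≡ 1 [MOD d]) (π : NC d n) :
    letI := NC.boundedOrder h
    PosetHopf.of R (Set.Iic π) =
      ∏ B : π.1.parts, NC.toHopf R d B.1.card (π.2.2.1 B.1 B.2) := by
  let _ := NC.boundedOrder h
  let _ : ∀ B : π.1.parts, BoundedOrder (NC d B.1.card) :=
    fun B => NC.boundedOrder (π.2.2.1 B.1 B.2)
  obtain ⟨e⟩ := exists_nc_iicIso h π
  rw [PosetHopf.of_eq_of_iso e, PosetHopf.of_pi]
  rfl

theorem of_Ici (h : n ≡ 1 [MOD d]) (π : NC d n) :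
    letI := NC.boundedOrder h
    PosetHopf.of R (Set.Ici π) =
      ∏ C : (krewerasDual π.1).parts, NC.toHopf R d C.1.card (π.2.2.2 C.1 C.2) := by
  let _ := NC.boundedOrder h
  let _ : ∀ C : (krewerasDual π.1).parts, BoundedOrder (NC d C.1.card) :=
    fun C => NC.boundedOrder (π.2.2.2 C.1 C.2)
  obtain ⟨e⟩ := exists_nc_iciIso h π
  rw [PosetHopf.of_eq_of_iso e, PosetHopf.of_pi]
  rfl

end

/-! ## Components and acyclic hypergraphs -/

section

variable {α : Type*}

/-- The equivalence relation whose classes are the connected components of a hypergraph. -/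
def comp (F : Finset (Finset α)) : Setoid α := sInf {s | ∀ E ∈ F, ∀ x ∈ E, ∀ y ∈ E, s x y}

theorem comp_of_mem {F : Finset (Finset α)} {E : Finset α} (hE : E ∈ F) {x y : α} (hx : x ∈ E)
    (hy : y ∈ E) : comp F x y :=
  fun _ hs => hs E hE x hx y hy

theorem comp_le {F : Finset (Finset α)} {s : Setoid α} (h : ∀ E ∈ F, ∀ x ∈ E, ∀ y ∈ E, s x y) :
    comp F ≤ s :=
  sInf_le h

/-- The relation `P x ↔ P y` is an equivalence relation; if it holds along all edges, it contains
`comp F`. -/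
theorem comp_ind {F : Finset (Finset α)} {x y : α} (h : comp F x y) (P : α → Prop)
    (hP : ∀ E ∈ F, ∀ a ∈ E, ∀ b ∈ E, P a → P b) (hx : P x) : P y := by
  have : comp F ≤ Setoid.ker P := comp_le fun E hE a ha b hb =>
    propext ⟨hP E hE a ha b hb, hP E hE b hb a ha⟩
  exact cast (this h) hx

theorem comp_mono {F G : Finset (Finset α)} (h : F ⊆ G) : comp F ≤ comp G :=
  comp_le fun _ hE _ hx _ hy => comp_of_mem (h hE) hx hy

theorem comp_empty {x y : α} (h : comp (∅ : Finset (Finset α)) x y) : x = y :=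
  comp_ind h (fun z => x = z) (by simp) rfl

/-- The number of connected components. -/
noncomputable def numComp (F : Finset (Finset α)) : ℕ := Nat.card (Quotient (comp F))

theorem numComp_empty : numComp (∅ : Finset (Finset α)) = Nat.card α := by
  rw [numComp]
  refine Nat.card_congr (Equiv.ofBijective (Quotient.mk _) ⟨fun x y h => ?_, ?_⟩).symm
  · exact comp_empty (Quotient.exact h)
  · exact Quotient.mk_surjective

theorem numComp_eq_one_iff [Nonempty α] {F : Finset (Finset α)} :
    numComp F = 1 ↔ comp F = ⊤ := by
  rw [numComp, Nat.card_eq_one_iff_unique]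
  constructor
  · rintro ⟨h, -⟩
    refine eq_top_iff.2 fun x y _ => Quotient.exact (Subsingleton.elim _ _)
  · intro h
    refine ⟨⟨fun q r => ?_⟩, ⟨Quotient.mk _ (Classical.arbitrary α)⟩⟩
    induction q using Quotient.inductionOn with | _ x
    induction r using Quotient.inductionOn with | _ y
    exact Quotient.sound (show comp F x y by rw [h]; trivial)

variable [DecidableEq α]

theorem comp_insert {F : Finset (Finset α)} {C : Finset α} {x y : α} (h : comp (insert C F) x y) :
    comp F x y ∨ ∃ c ∈ C, ∃ c' ∈ C, comp F x c ∧ comp F c' y := by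
  refine comp_ind h (fun y => comp F x y ∨ ∃ c ∈ C, ∃ c' ∈ C, comp F x c ∧ comp F c' y) ?_
    (Or.inl ((comp F).refl' x))
  intro E hE a ha b hb hPa
  rcases mem_insert.1 hE with rfl | hE
  · rcases hPa with h | ⟨c, hc, -, -, h, -⟩
    · exact Or.inr ⟨a, ha, b, hb, h, (comp F).refl' b⟩
    · exact Or.inr ⟨c, hc, b, hb, h, (comp F).refl' b⟩
  · have hab := comp_of_mem hE ha hb
    rcases hPa with h | ⟨c, hc, c', hc', h, h'⟩
    · exact Or.inl ((comp F).trans' h hab)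
    · exact Or.inr ⟨c, hc, c', hc', h, (comp F).trans' h' hab⟩

/-- A hypergraph is acyclic if no two vertices of an edge are connected by the other edges. -/
def IsAcyclic (F : Finset (Finset α)) : Prop :=
  ∀ E ∈ F, ∀ x ∈ E, ∀ y ∈ E, comp (F.erase E) x y → x = y

theorem IsAcyclic.subset {F G : Finset (Finset α)} (h : IsAcyclic G) (hFG : F ⊆ G) : IsAcyclic F :=
  fun E hE x hx y hy hxy => h E (hFG hE) x hx y hy (comp_mono (erase_subset_erase E hFG) hxy)

theorem IsAcyclic.insert {F : Finset (Finset α)} (h : IsAcyclic F) {C : Finset α}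
    (hC : ∀ x ∈ C, ∀ y ∈ C, comp F x y → x = y) : IsAcyclic (insert C F) := by
  intro E hE x hx y hy hxy
  by_cases hEC : E = C
  · subst hEC
    rw [erase_insert_eq_erase] at hxy
    exact hC x hx y hy (comp_mono (erase_subset _ _) hxy)
  · have hE := (mem_insert.1 hE).resolve_left hEC
    have h0 := comp_mono (erase_subset E F)
    rw [erase_insert_of_ne (Ne.symm hEC)] at hxy
    rcases comp_insert hxy with h1 | ⟨c, hc, c', hc', h1, h2⟩
    · exact h E hE x hx y hy h1
    · obtain rfl := hC c hc c' hc' ((comp F).trans' ((comp F).symm' (h0 h1))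
        ((comp F).trans' (comp_of_mem hE hx hy) ((comp F).symm' (h0 h2))))
      exact h E hE x hx y hy ((comp _).trans' h1 h2)

theorem IsAcyclic.transversal {F : Finset (Finset α)} {C : Finset α}
    (h : IsAcyclic (Insert.insert C F)) (hC : C ∉ F) : ∀ x ∈ C, ∀ y ∈ C, comp F x y → x = y := by
  intro x hx y hy hxy
  refine h C (mem_insert_self _ _) x hx y hy ?_
  rwa [erase_insert hC]

/-! ### Counting components -/

variable [Fintype α]

-- The new edge merges the components that meet `C`, the elements of `M`, into a single one and
-- leaves all others alone.
open Classical in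
theorem numComp_insert (F : Finset (Finset α)) {C : Finset α} (hC : C.Nonempty) :
    numComp (insert C F) + (C.image (Quotient.mk (comp F))).card = numComp F + 1 := by
  obtain ⟨c0, hc0⟩ := hC
  set M := C.image (Quotient.mk (comp F)) with hM
  have hmem : ∀ x, Quotient.mk (comp F) x ∈ M ↔ ∃ c ∈ C, comp F c x := fun x => by
    simp only [hM, mem_image, Quotient.eq]
  have hout : ∀ x, (∃ c ∈ C, comp F c x) ↔ comp (insert C F) x c0 := fun x => by
    constructor
    · rintro ⟨c, hc, h⟩
      exact (comp _).trans' ((comp _).symm' (comp_mono (subset_insert C F) h))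
        (comp_of_mem (mem_insert_self C F) hc hc0)
    · intro h
      rcases comp_insert h with h | ⟨c, hc, -, -, h, -⟩
      · exact ⟨c0, hc0, (comp F).symm' h⟩
      · exact ⟨c, hc, (comp F).symm' h⟩
  let f : Quotient (comp F) → Quotient (comp (insert C F)) :=
    Quotient.map id fun _ _ h => comp_mono (subset_insert C F) h
  have key : (Mᶜ).card = (univ.erase (Quotient.mk (comp (insert C F)) c0)).card := by
    refine card_bij (fun q _ => f q) ?_ ?_ ?_
    · intro q
      induction q using Quotient.inductionOn with | _ x
      intro hx
      rw [mem_compl, hmem, hout] at hx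
      exact mem_erase.2 ⟨fun h => hx (Quotient.exact h), mem_univ _⟩
    · intro q hq r _ hqr
      induction q using Quotient.inductionOn with | _ x
      induction r using Quotient.inductionOn with | _ y
      rw [mem_compl, hmem] at hq
      rcases comp_insert (Quotient.exact hqr : comp (insert C F) x y) with h | ⟨c, hc, -, -, h, -⟩
      · exact Quotient.sound h
      · exact absurd ⟨c, hc, (comp F).symm' h⟩ hq
    · intro b hb
      induction b using Quotient.inductionOn with | _ x
      refine ⟨Quotient.mk _ x, ?_, rfl⟩
      rw [mem_compl, hmem, hout]
      exact fun h => (mem_erase.1 hb).1 (Quotient.sound h)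
  rw [card_erase_of_mem (mem_univ _), card_compl, card_univ] at key
  have h1 := Finset.card_le_univ M
  have h2 : 0 < Fintype.card (Quotient (comp (insert C F))) :=
    Fintype.card_pos_iff.2 ⟨Quotient.mk _ c0⟩
  simp only [numComp, Nat.card_eq_fintype_card]
  omega

/-- An edge `C` reduces the number of components by at most `|C| - 1`, and by exactly this much if
its vertices lie in different components. So equality characterizes acyclic hypergraphs, as the next
two results show; this is how the edge count of a hypertree enters. -/
theorem card_le_numComp (F : Finset (Finset α)) (hF : ∀ E ∈ F, E.Nonempty) :
    (Fintype.card α : ℤ) ≤ numComp F + ∑ E ∈ F, ((E.card : ℤ) - 1) := by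
  classical
  induction F using Finset.induction_on with
  | empty => simp [numComp_empty]
  | insert C F hC ih =>
    have h1 := ih fun E hE => hF E (mem_insert_of_mem hE)
    have h2 := numComp_insert F (hF C (mem_insert_self _ _))
    have h3 : (C.image (Quotient.mk (comp F))).card ≤ C.card := card_image_le
    rw [sum_insert hC]
    omega

theorem IsAcyclic.card_eq {F : Finset (Finset α)} (h : IsAcyclic F) (hF : ∀ E ∈ F, E.Nonempty) :
    (Fintype.card α : ℤ) = numComp F + ∑ E ∈ F, ((E.card : ℤ) - 1) := by
  classical
  induction F using Finset.induction_on with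
  | empty => simp [numComp_empty]
  | insert C F hC ih =>
    have h1 := ih (h.subset (subset_insert _ _)) fun E hE => hF E (mem_insert_of_mem hE)
    have h2 := numComp_insert F (hF C (mem_insert_self _ _))
    have h3 : (C.image (Quotient.mk (comp F))).card = C.card := card_image_of_injOn
      fun x hx y hy hxy => h.transversal hC x hx y hy (Quotient.exact hxy)
    rw [sum_insert hC]
    omega

theorem isAcyclic_of_card_eq {F : Finset (Finset α)} (hF : ∀ E ∈ F, E.Nonempty)
    (h : (Fintype.card α : ℤ) = numComp F + ∑ E ∈ F, ((E.card : ℤ) - 1)) : IsAcyclic F := by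
  classical
  intro E hE x hx y hy hxy
  have h1 := card_le_numComp (F.erase E) fun G hG => hF G (mem_of_mem_erase hG)
  have h2 := numComp_insert (F.erase E) (hF E hE)
  rw [insert_erase hE] at h2
  have h3 : (E.image (Quotient.mk (comp (F.erase E)))).card ≤ E.card := card_image_le
  have h4 := sum_erase_add F (fun E => (E.card : ℤ) - 1) hE
  refine card_image_iff.1 (le_antisymm h3 (by omega)) hx hy (Quotient.sound hxy)

end

theorem isConnectedHypergraph_iff {T : Finset (Finset (Fin n))} :
    IsConnectedHypergraph T ↔ comp T = ⊤ := by
  constructor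
  · intro h
    refine eq_top_iff.2 fun x y _ => ?_
    by_cases hxy : x = y
    · subst hxy
      exact (comp T).refl' x
    obtain ⟨E, hE, F, hF, hx, hy, hEF⟩ := h x y hxy
    have key : ∀ y ∈ F, comp T x y := by
      clear hF hy
      induction hEF with
      | refl => exact fun y hy => comp_of_mem hE hx hy
      | tail _ hAB ih =>
        obtain ⟨hA, hB, z, hz⟩ := hAB
        rw [mem_inter] at hz
        exact fun y hy => (comp T).trans' (ih z hz.1) (comp_of_mem hB hz.2 hy)
    exact key y hy
  · intro h x y hxy
    have hc : comp T x y := by rw [h]; trivial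
    have := comp_ind hc (fun z => z = x ∨ ∃ E ∈ T, ∃ F ∈ T, x ∈ E ∧ z ∈ F ∧
      Relation.ReflTransGen (fun A B => A ∈ T ∧ B ∈ T ∧ (A ∩ B).Nonempty) E F) ?_ (Or.inl rfl)
    · exact this.resolve_left (Ne.symm hxy)
    · rintro G hG a ha b hb (rfl | ⟨E, hE, F, hF, hx, hz, hEF⟩)
      · exact Or.inr ⟨G, hG, G, hG, ha, hb, Relation.ReflTransGen.refl⟩
      · exact Or.inr ⟨E, hE, G, hG, hx, hb, hEF.tail ⟨hF, hG, a, mem_inter.2 ⟨hz, ha⟩⟩⟩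

theorem IsHypergraph.nonempty {T : Finset (Finset (Fin n))} (h : IsHypergraph T) :
    ∀ E ∈ T, E.Nonempty := fun E hE => card_pos.1 (by have := h E hE; omega)

/-- Hypertrees are the connected acyclic hypergraphs. -/
theorem isHypertree_iff (hn : 0 < n) {T : Finset (Finset (Fin n))} :
    IsHypertree T ↔ IsHypergraph T ∧ comp T = ⊤ ∧ IsAcyclic T := by
  have : Nonempty (Fin n) := ⟨⟨0, hn⟩⟩
  rw [IsHypertree, isConnectedHypergraph_iff]
  refine and_congr_right fun h => and_congr_right fun hc => ?_
  rw [← numComp_eq_one_iff] at hc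
  constructor
  · intro hs
    refine isAcyclic_of_card_eq (IsHypergraph.nonempty h) ?_
    rw [Fintype.card_fin, hs, hc]
    omega
  · intro ha
    have := ha.card_eq (IsHypergraph.nonempty h)
    rw [Fintype.card_fin, hc] at this
    omega

/-- The components of a noncrossing hypergraph do not cross. -/
theorem isNoncr_comp {F : Finset (Finset (Fin n))} (hF : IsNoncrossing F) : IsNoncr (comp F) := by
  intro i j k l hij hjk hkl hik hjl
  by_contra hn
  have hne : ∀ z, comp F i z → z ≠ j ∧ z ≠ l := fun z hz => by
    refine ⟨?_, ?_⟩
    · rintro rfl; exact hn hz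
    · rintro rfl; exact hn ((comp F).trans' hz ((comp F).symm' hjl))
  -- A path from `i` to `k` must enter the interval between `j` and `l` through some edge `E`.
  obtain ⟨E, hE, x, hx, y, hy, hix, hxo, hyi⟩ : ∃ E ∈ F, ∃ x ∈ E, ∃ y ∈ E,
      comp F i x ∧ (x < j ∨ l < x) ∧ (j < y ∧ y < l) := by
    by_contra hno
    push Not at hno
    have := comp_ind hik (fun z => comp F i z ∧ (z < j ∨ l < z)) (fun E hE a ha b hb hab => ?_)
      ⟨(comp F).refl' i, Or.inl hij⟩
    · omega
    · have hib := (comp F).trans' hab.1 (comp_of_mem hE ha hb)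
      have := hno E hE a ha b hb hab.1 hab.2
      have := hne b hib
      refine ⟨hib, ?_⟩
      omega
  have hiy := (comp F).trans' hix (comp_of_mem hE hx hy)
  have hjn : ∀ z, comp F j z → z ≠ x ∧ z ≠ y ∧ z ∉ E := fun z hz => by
    have h1 : ¬ comp F i z := fun h => hn ((comp F).trans' h ((comp F).symm' hz))
    refine ⟨?_, ?_, fun h => h1 ((comp F).trans' hix (comp_of_mem hE hx h))⟩
    · rintro rfl; exact h1 hix
    · rintro rfl; exact h1 hiy
  -- The points `j` and `l` lie on different sides of the chord from `x` to `y`, but no edge of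
  -- their component crosses this chord, because it would cross `E`. The invariant says that `z` is
  -- on the same side as `j`.
  have := comp_ind hjl (fun z => comp F j z ∧ ((x < z ∧ z < y ∨ y < z ∧ z < x) ↔ x < j))
    (fun D hD a ha b hb hab => ?_) ⟨(comp F).refl' j, by omega⟩
  · omega
  have hjb := (comp F).trans' hab.1 (comp_of_mem hD ha hb)
  have hDE : D ≠ E := by
    rintro rfl
    exact (hjn a hab.1).2.2 ha
  have key : ∀ lo ∈ E, ∀ hi ∈ E, ∀ u ∈ D, ∀ v ∈ D, v ≠ lo → v ≠ hi → lo < u → u < hi →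
      lo < v ∧ v < hi := by
    intro lo hlo hi hhi u hu v hv h1 h2 h3 h4
    by_contra h
    by_cases h5 : v < lo
    · exact hF D hD E hE hDE ⟨v, lo, u, hi, h5, h3, h4, hv, hu, hlo, hhi⟩
    · exact hF E hE D hD hDE.symm ⟨lo, u, hi, v, h3, h4, by omega, hlo, hhi, hu, hv⟩
  obtain ⟨ha1, ha2, -⟩ := hjn a hab.1
  obtain ⟨hb1, hb2, -⟩ := hjn b hjb
  have k1 := key x hx y hy a ha b hb hb1 hb2
  have k2 := key x hx y hy b hb a ha ha1 ha2
  have k3 := key y hy x hx a ha b hb hb2 hb1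
  have k4 := key y hy x hx b hb a ha ha2 ha1
  refine ⟨hjb, ?_⟩
  omega

/-! ## Noncrossing forests and a sign reversing involution -/

/-- A noncrossing forest is a noncrossing acyclic hypergraph. -/
def IsForest (F : Finset (Finset (Fin n))) : Prop :=
  IsHypergraph F ∧ IsNoncrossing F ∧ IsAcyclic F

/-- Applied to `t = kr (comp F)`, this says that different dual classes remain noncrossing in the
strong sense of `SameSide` when the points `i'` are read as vertices `i`. -/
theorem sameSide_of_isNoncr {t : Setoid (Fin n)} (ht : IsNoncr t) {p q a b : Fin n} (hpq : t p q)
    (hab : t a b) (hpa : ¬ t p a) : SameSide p q a b := by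
  wlog hlt : p < q generalizing p q
  · rcases lt_trichotomy p q with h | rfl | h
    · exact this hpq hpa h
    · exact (kr t).refl' p a b hab
    · exact (this (t.symm' hpq) (fun hqa => hpa (t.trans' hpq hqa)) h).swap
  have hne : ∀ z, t a z → z ≠ p ∧ z ≠ q := fun z hz => by
    refine ⟨?_, ?_⟩
    · rintro rfl; exact hpa (t.symm' hz)
    · rintro rfl; exact hpa (t.trans' hpq (t.symm' hz))
  have key : ∀ u v, t a u → t a v → p < u → u ≤ q → p < v ∧ v ≤ q := by
    intro u v hu hv h1 h2
    have huv := t.trans' (t.symm' hu) hv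
    have := hne u hu
    have := hne v hv
    have h3 : ¬ v < p := fun h => hpa (t.symm' (t.trans' hv
      (ht v p u q h h1 (by omega) (t.symm' huv) hpq)))
    have h4 : ¬ q < v := fun h => hpa (t.trans' (ht p u q v h1 (by omega) h hpq huv) (t.symm' hu))
    omega
  rw [sameSide_iff_of_lt hlt]
  exact ⟨fun h => key a b (t.refl' a) hab h.1 h.2, fun h => key b a hab (t.refl' a) h.1 h.2⟩

theorem kr_comp_iff {F : Finset (Finset (Fin n))} {p q : Fin n} :
    kr (comp F) p q ↔ ∀ E ∈ F, ∀ a ∈ E, ∀ b ∈ E, SameSide p q a b :=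
  ⟨fun h _ hE _ ha _ hb => h _ _ (comp_of_mem hE ha hb), fun h a _ hab =>
    comp_ind hab (fun z => SameSide p q a z)
      (fun E hE x hx y hy hax => hax.trans (h E hE x hx y hy)) Iff.rfl⟩

open Classical in
/-- The classes of the Kreweras dual of the components that have at least two elements. -/
noncomputable def dualClasses (F : Finset (Finset (Fin n))) : Finset (Finset (Fin n)) :=
  univ.filter fun C => 2 ≤ C.card ∧ ∀ x ∈ C, ∀ y, kr (comp F) x y ↔ y ∈ C

section

variable {F : Finset (Finset (Fin n))} {C D : Finset (Fin n)}

theorem mem_dualClasses :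
    C ∈ dualClasses F ↔ 2 ≤ C.card ∧ ∀ x ∈ C, ∀ y, kr (comp F) x y ↔ y ∈ C := by
  simp [dualClasses]

theorem exists_mem_dualClasses {x y : Fin n} (h : kr (comp F) x y) (hxy : x ≠ y) :
    ∃ C ∈ dualClasses F, x ∈ C ∧ y ∈ C := by
  classical
  refine ⟨univ.filter fun z => kr (comp F) x z, mem_dualClasses.2 ⟨?_, ?_⟩, ?_, ?_⟩
  · exact one_lt_card.2 ⟨x, by simp, y, by simpa using h, hxy⟩
  · intro u hu v
    simp only [mem_filter, mem_univ, true_and] at hu ⊢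
    exact ⟨fun h => (kr _).trans' hu h, fun h => (kr _).trans' ((kr _).symm' hu) h⟩
  · simp
  · simpa using h

theorem eq_of_mem_dualClasses (hC : C ∈ dualClasses F) (hD : D ∈ dualClasses F) {x : Fin n}
    (hx : x ∈ C) (hx' : x ∈ D) : C = D := by
  ext y
  rw [← (mem_dualClasses.1 hC).2 x hx, (mem_dualClasses.1 hD).2 x hx']

theorem transversal_of_mem_dualClasses (hC : C ∈ dualClasses F) :
    ∀ x ∈ C, ∀ y ∈ C, comp F x y → x = y :=
  fun x hx y hy h => eq_of_kr h (((mem_dualClasses.1 hC).2 x hx y).2 hy)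

theorem exists_ne_of_two_le_card (hC : 2 ≤ C.card) (x : Fin n) : ∃ y ∈ C, y ≠ x :=
  exists_mem_ne (by omega) x

theorem notMem_of_mem_dualClasses (hC : C ∈ dualClasses F) : C ∉ F := by
  intro h
  obtain ⟨x, hx, y, hy, hxy⟩ := one_lt_card.1 (mem_dualClasses.1 hC).1
  exact hxy (transversal_of_mem_dualClasses hC x hx y hy (comp_of_mem h hx hy))

theorem IsForest.subset {G : Finset (Finset (Fin n))} (hG : IsForest G) (h : F ⊆ G) :
    IsForest F :=
  ⟨fun E hE => hG.1 E (h hE), fun B hB C hC => hG.2.1 B (h hB) C (h hC), hG.2.2.subset h⟩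

theorem IsForest.insert (hF : IsForest F) (hC : C ∈ dualClasses F) : IsForest (insert C F) := by
  have hC' := mem_dualClasses.1 hC
  have hs : ∀ E ∈ F, ∀ p ∈ C, ∀ q ∈ C, ∀ a ∈ E, ∀ b ∈ E, SameSide p q a b :=
    fun E hE p hp q hq => kr_comp_iff.1 ((hC'.2 p hp q).2 hq) E hE
  refine ⟨?_, ?_, hF.2.2.insert (transversal_of_mem_dualClasses hC)⟩
  · intro E hE
    rcases mem_insert.1 hE with rfl | hE
    · exact hC'.1
    · exact hF.1 E hE
  · intro B hB D hD hne
    rcases mem_insert.1 hB with rfl | hB' <;> rcases mem_insert.1 hD with rfl | hD'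
    · exact absurd rfl hne
    · rintro ⟨i, j, k, l, hij, hjk, hkl, hi, hk, hj, hl⟩
      have := hs D hD' i hi k hk j hj l hl
      rw [sameSide_iff_of_lt (hij.trans hjk)] at this
      omega
    · rintro ⟨i, j, k, l, hij, hjk, hkl, hi, hk, hj, hl⟩
      have := hs B hB' j hj l hl i hi k hk
      rw [sameSide_iff_of_lt (hjk.trans hkl)] at this
      omega
    · exact hF.2.1 B hB' D hD' hne

/-- Two points of `C` become related in the components, so they cannot stay dually related. A dual
class other than `C` survives because the edge `C` lies on one side of each of its chords. -/
theorem kr_comp_insert (hC : C ∈ dualClasses F) {p q : Fin n} :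
    kr (comp (insert C F)) p q ↔ p = q ∨ p ∉ C ∧ kr (comp F) p q := by
  have hC' := (mem_dualClasses.1 hC).2
  constructor
  · intro h
    have h' := kr_antitone (comp_mono (subset_insert C F)) h
    by_cases hp : p ∈ C
    · exact Or.inl (eq_of_kr (comp_of_mem (mem_insert_self C F) hp ((hC' p hp q).1 h')) h)
    · exact Or.inr ⟨hp, h'⟩
  · rintro (rfl | ⟨hp, h⟩)
    · exact (kr _).refl' p
    rw [kr_comp_iff]
    intro E hE a ha b hb
    rcases mem_insert.1 hE with rfl | hE
    · exact sameSide_of_isNoncr (isNoncr_kr _) h ((hC' a ha b).2 hb)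
        fun hpa => hp ((hC' a ha p).1 ((kr _).symm' hpa))
    · exact kr_comp_iff.1 h E hE a ha b hb

theorem dualClasses_insert (hC : C ∈ dualClasses F) :
    dualClasses (insert C F) = (dualClasses F).erase C := by
  ext D
  rw [mem_erase]
  constructor
  · intro hD
    have hD' := mem_dualClasses.1 hD
    have hx : ∀ x ∈ D, x ∉ C := fun x hx => by
      obtain ⟨y, hy, hyx⟩ := exists_ne_of_two_le_card hD'.1 x
      exact ((kr_comp_insert hC).1 ((hD'.2 x hx y).2 hy)).resolve_left (Ne.symm hyx) |>.1
    refine ⟨?_, mem_dualClasses.2 ⟨hD'.1, fun x hxD y => ?_⟩⟩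
    · rintro rfl
      obtain ⟨x, hxD⟩ := card_pos.1 (by omega : 0 < D.card)
      exact hx x hxD hxD
    · rw [← hD'.2 x hxD, kr_comp_insert hC]
      refine ⟨fun h => Or.inr ⟨hx x hxD, h⟩, ?_⟩
      rintro (rfl | h)
      · exact (kr _).refl' x
      · exact h.2
  · rintro ⟨hDC, hD⟩
    have hD' := mem_dualClasses.1 hD
    refine mem_dualClasses.2 ⟨hD'.1, fun x hxD y => ?_⟩
    have hx : x ∉ C := fun hx => hDC (eq_of_mem_dualClasses hD hC hxD hx)
    rw [← hD'.2 x hxD, kr_comp_insert hC]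
    refine ⟨?_, fun h => Or.inr ⟨hx, h⟩⟩
    rintro (rfl | h)
    · exact (kr _).refl' x
    · exact h.2

end

/-! ### Outermost edges of the completion -/

/-- The completion of a forest by the dual classes. -/
noncomputable def completion (F : Finset (Finset (Fin n))) : Finset (Finset (Fin n)) :=
  F ∪ dualClasses F

/-- An edge is outermost if it lies in one class of the Kreweras dual of the other edges. -/
def IsOutermost (T : Finset (Finset (Fin n))) (E : Finset (Fin n)) : Prop :=
  ∀ e ∈ E, ∀ e' ∈ E, ∀ G ∈ T, G ≠ E → ∀ a ∈ G, ∀ b ∈ G, SameSide e e' a b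

section

variable {F : Finset (Finset (Fin n))} {C E : Finset (Fin n)}

theorem completion_insert (hC : C ∈ dualClasses F) : completion (insert C F) = completion F := by
  rw [completion, completion, dualClasses_insert hC]
  ext D
  simp only [mem_union, mem_insert, mem_erase]
  by_cases h : D = C
  · subst h
    simp [hC]
  · simp [h]

theorem isOutermost_of_mem_dualClasses (hC : C ∈ dualClasses F) :
    IsOutermost (completion F) C := by
  intro e he e' he' G hG hGC a ha b hb
  have hee' := ((mem_dualClasses.1 hC).2 e he e').2 he'
  rcases mem_union.1 hG with hG | hG
  · exact kr_comp_iff.1 hee' G hG a ha b hb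
  · have hG' := (mem_dualClasses.1 hG).2 a ha
    refine sameSide_of_isNoncr (isNoncr_kr _) hee' ((hG' b).2 hb) fun h => hGC ?_
    exact eq_of_mem_dualClasses hG hC ha (((mem_dualClasses.1 hC).2 e he a).1 h)

/-- Since `E` is outermost, it lies in one dual class of the other edges; the point is that it is
the whole class. An additional point `p` would be dual in `F` to the vertex `e` of `E` cyclically
preceding it. The dual class of `F` through `p` and `e` belongs to the completion, and a chord of
`E` starting at `e'` separates `p` from `e`, a contradiction. -/
theorem mem_dualClasses_erase (hF : IsForest F) (hE : E ∈ F) (ho : IsOutermost (completion F) E) :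
    E ∈ dualClasses (F.erase E) := by
  have hcard := hF.1 E hE
  have h0 : ∀ x ∈ E, ∀ y ∈ E, kr (comp (F.erase E)) x y := fun x hx y hy =>
    kr_comp_iff.2 fun G hG => ho x hx y hy G (mem_union_left _ (mem_of_mem_erase hG))
      (ne_of_mem_erase hG)
  refine mem_dualClasses.2 ⟨hcard, fun x hx p => ⟨fun hxp => ?_, fun hp => h0 x hx p hp⟩⟩
  by_contra hp
  have key : ∀ e ∈ E, (∀ a ∈ E, ∀ b ∈ E, SameSide p e a b) → ∀ e' ∈ E, SameSide e e' e p := by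
    intro e he hside e' he'
    have hk : kr (comp F) p e := by
      rw [kr_comp_iff]
      intro G hG
      by_cases hGE : G = E
      · subst hGE
        exact hside
      · exact kr_comp_iff.1 ((kr _).trans' ((kr _).symm' hxp) (h0 x hx e he)) G
          (mem_erase.2 ⟨hGE, hG⟩)
    obtain ⟨C, hC, hpC, heC⟩ := exists_mem_dualClasses hk (by rintro rfl; exact hp he)
    exact ho e he e' he' C (mem_union_right _ hC) (by rintro rfl; exact hp hpC) e heC p hpC
  have hne : ∀ a ∈ E, a ≠ p := by rintro a ha rfl; exact hp ha
  by_cases hsplit : (∃ e, e ∈ E ∧ e < p) ∧ ∃ e, e ∈ E ∧ p < e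
  · obtain ⟨he, e2, he2, hpe2⟩ := hsplit
    obtain ⟨e, ⟨heE, hep⟩, hem⟩ := exists_max he
    have hside : ∀ a ∈ E, ∀ b ∈ E, SameSide p e a b := by
      intro a ha b hb
      refine SameSide.swap ?_
      rw [sameSide_iff_of_lt hep]
      have := hne a ha
      have := hne b hb
      have h1 : a < p → a ≤ e := fun h => hem a ⟨ha, h⟩
      have h2 : b < p → b ≤ e := fun h => hem b ⟨hb, h⟩
      omega
    have := key e heE hside e2 he2
    rw [sameSide_iff_of_lt (hep.trans hpe2)] at this
    omega
  -- Here `p` lies before or after all of `E`, so its cyclic predecessor in `E` is the maximum, and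
  -- the minimum is the other end of the separating chord.
  · obtain ⟨e, he, hem⟩ := exists_max (P := fun e => e ∈ E) ⟨x, hx⟩
    obtain ⟨e', he', hem'⟩ := exists_min (P := fun e => e ∈ E) ⟨x, hx⟩
    have hlt : e' < e := by
      obtain ⟨y, hy, hyx⟩ := exists_ne_of_two_le_card hcard x
      have := hem x hx
      have := hem y hy
      have := hem' x hx
      have := hem' y hy
      omega
    have hall : (∀ a ∈ E, p < a) ∨ ∀ a ∈ E, a < p := by
      by_contra hcon
      push Not at hcon
      obtain ⟨⟨u, hu, hup⟩, v, hv, hvp⟩ := hcon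
      have := hne u hu
      have := hne v hv
      exact hsplit ⟨⟨u, hu, by omega⟩, v, hv, by omega⟩
    have hside : ∀ a ∈ E, ∀ b ∈ E, SameSide p e a b := by
      intro a ha b hb
      have := hem a ha
      have := hem b hb
      rcases hall with h | h
      · have := h a ha
        have := h b hb
        rw [sameSide_iff_of_lt (h e he)]
        omega
      · have := h a ha
        have := h b hb
        refine SameSide.swap ?_
        rw [sameSide_iff_of_lt (h e he)]
        omega
    have := (key e he hside e' he').swap
    rw [sameSide_iff_of_lt hlt] at this
    rcases hall with h | h
    · have := h e' he'
      omega
    · have := h e he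
      omega

/-- The distance from `v` to `u` in the cyclic order. -/
def cycDist (v u : Fin n) : ℕ := if v ≤ u then u.val - v.val else n - v.val + u.val

theorem exists_nearest_edge (hn : 2 ≤ n) (hc : comp F = ⊤) (v : Fin n) :
    ∃ E ∈ F, v ∈ E ∧ ∃ u ∈ E, u ≠ v ∧
      ∀ G ∈ F, v ∈ G → ∀ w ∈ G, w ≠ v → cycDist v u ≤ cycDist v w := by
  have hex : ∃ q : Finset (Fin n) × Fin n, q.1 ∈ F ∧ v ∈ q.1 ∧ q.2 ∈ q.1 ∧ q.2 ≠ v := by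
    by_contra hno
    push Not at hno
    have hvw : ∃ w : Fin n, w ≠ v := by
      have : Nontrivial (Fin n) := Fin.nontrivial_iff_two_le.2 hn
      exact exists_ne v
    obtain ⟨w, hw⟩ := hvw
    have hcomp : comp F v w := by rw [hc]; trivial
    refine hw (comp_ind hcomp (fun z => z = v) ?_ rfl)
    rintro G hG a ha b hb rfl
    exact hno (G, b) hG ha hb
  obtain ⟨⟨E, u⟩, ⟨hE, hv, hu, huv⟩, hmin⟩ := Set.exists_min_image
    {q : Finset (Fin n) × Fin n | q.1 ∈ F ∧ v ∈ q.1 ∧ q.2 ∈ q.1 ∧ q.2 ≠ v}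
    (fun q => cycDist v q.2) (Set.toFinite _) hex
  exact ⟨E, hE, hv, u, hu, huv, fun G hG hvG w hw hwv => hmin (G, w) ⟨hG, hvG, hw, hwv⟩⟩

/-- By acyclicity another edge `G` meets `E` in at most one vertex. Being noncrossing, `G` can be
separated by a chord of `E` only if they share a vertex `v` and the rest of `G` lies between `v` and
the next vertex of `E`, since the chord starts just after `v`. Then `G` would contain a nearer
cyclic successor of `v` than `E` does. -/
theorem isOutermost_of_nearest (hF : IsForest F) (hE : E ∈ F)
    (hnear : ∀ v ∈ E, ∃ u ∈ E, u ≠ v ∧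
      ∀ G ∈ F, v ∈ G → ∀ w ∈ G, w ≠ v → cycDist v u ≤ cycDist v w) : IsOutermost F E := by
  intro e he e' he' G hG hGE
  have htrans : ∀ x ∈ E, ∀ y ∈ E, x ∈ G → y ∈ G → x = y := fun x hx y hy hx' hy' =>
    hF.2.2 E hE x hx y hy (comp_of_mem (mem_erase.2 ⟨hGE, hG⟩) hx' hy')
  have c1 : ∀ i ∈ E, ∀ j ∈ G, ∀ k ∈ E, ∀ l ∈ G, ¬ (i < j ∧ j < k ∧ k < l) :=
    fun i hi j hj k hk l hl ⟨hij, hjk, hkl⟩ =>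
      hF.2.1 E hE G hG hGE.symm ⟨i, j, k, l, hij, hjk, hkl, hi, hk, hj, hl⟩
  have c2 : ∀ i ∈ G, ∀ j ∈ E, ∀ k ∈ G, ∀ l ∈ E, ¬ (i < j ∧ j < k ∧ k < l) :=
    fun i hi j hj k hk l hl ⟨hij, hjk, hkl⟩ =>
      hF.2.1 G hG E hE hGE ⟨i, j, k, l, hij, hjk, hkl, hi, hk, hj, hl⟩
  have key : ∀ e ∈ E, ∀ e' ∈ E, e < e' → ∀ x ∈ G, ∀ y ∈ G, e < x → x ≤ e' → e < y ∧ y ≤ e' := by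
    intro e he e' he' hee' x hx y hy hex hxe'
    by_contra hcon
    -- The shared vertex is either the right end `x = e'` of the interval or its left end `y = e`.
    rcases eq_or_lt_of_le hxe' with rfl | hxe'
    · have hye : y ≠ e := by
        rintro rfl
        exact hex.ne (htrans y he x he' hy hx)
      have hyx : y ≠ x := by
        rintro rfl
        exact hcon ⟨hex, le_rfl⟩
      obtain ⟨u, hu, hux, hmin⟩ := hnear x he'
      have hd := hmin G hG hx y hy hyx
      have huy : u ≠ y := by
        rintro rfl
        exact hux (htrans u hu x he' hy hx)
      have k1 := c1 e he x hx u hu y hy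
      have k2 := c2 y hy e he x hx u hu
      have k3 := c1 u hu y hy e he x hx
      simp only [cycDist] at hd
      split_ifs at hd <;> omega
    · have k1 := c2 y hy e he x hx e' he'
      have k2 := c1 e he x hx e' he' y hy
      have hye' : y ≠ e' := by
        rintro rfl
        exact hcon ⟨hee', le_rfl⟩
      obtain rfl : y = e := by omega
      obtain ⟨u, hu, hue, hmin⟩ := hnear y he
      have hd := hmin G hG hy x hx hex.ne'
      have hux : u ≠ x := by
        rintro rfl
        exact hue (htrans u hu y he hx hy)
      have k3 := c2 y hy u hu x hx e' he'
      simp only [cycDist] at hd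
      split_ifs at hd <;> omega
  have key' : ∀ e ∈ E, ∀ e' ∈ E, e < e' → ∀ a ∈ G, ∀ b ∈ G, SameSide e e' a b := by
    intro e he e' he' hee' a ha b hb
    rw [sameSide_iff_of_lt hee']
    exact ⟨fun h => key e he e' he' hee' a ha b hb h.1 h.2,
      fun h => key e he e' he' hee' b hb a ha h.1 h.2⟩
  intro a ha b hb
  rcases lt_trichotomy e e' with h | rfl | h
  · exact key' e he e' he' h a ha b hb
  · simp [SameSide]
  · exact (key' e' he' e he h a ha b hb).swap

/-- Without dual classes to choose from, `F` is a tree. Each vertex selects an edge containing its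
nearest neighbour in cyclic order. If no edge were selected by all of its vertices, there would be
at most `∑ (|E| - 1) = n - 1` selections, but there are `n`. -/
theorem exists_isOutermost (hn : 2 ≤ n) (hF : IsForest F) :
    ∃ E ∈ completion F, IsOutermost (completion F) E := by
  classical
  by_cases hd : (dualClasses F).Nonempty
  · obtain ⟨C, hC⟩ := hd
    exact ⟨C, mem_union_right _ hC, isOutermost_of_mem_dualClasses hC⟩
  have hd := not_nonempty_iff_eq_empty.1 hd
  have hcompl : completion F = F := by rw [completion, hd, union_empty]
  rw [hcompl]
  have hlt : ∀ a b, a < b → comp F a b := by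
    intro a b hab
    by_contra h
    obtain ⟨p, q, hpq, hp, hq⟩ := exists_kr_separating (isNoncr_comp hF.2.1) hab h
    obtain ⟨C, hC, -⟩ := exists_mem_dualClasses hpq (by rintro rfl; exact hq hp)
    rw [hd] at hC
    exact notMem_empty C hC
  have hc : comp F = ⊤ := by
    refine eq_top_iff.2 fun a b _ => ?_
    rcases lt_trichotomy a b with h | rfl | h
    · exact hlt a b h
    · exact (comp F).refl' a
    · exact (comp F).symm' (hlt b a h)
  have : Nonempty (Fin n) := ⟨⟨0, by omega⟩⟩
  choose φ hφ hvφ hnear using exists_nearest_edge hn hc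
  have hcard := hF.2.2.card_eq (IsHypergraph.nonempty hF.1)
  rw [numComp_eq_one_iff.2 hc, Fintype.card_fin] at hcard
  obtain ⟨E, hE, hEφ⟩ : ∃ E ∈ F, ∀ v ∈ E, φ v = E := by
    by_contra hno
    push Not at hno
    have h1 := card_eq_sum_card_fiberwise (s := univ) (t := F) (f := φ) fun v _ => hφ v
    have h2 : ∀ E ∈ F, (((univ.filter fun v => φ v = E).card : ℕ) : ℤ) ≤ (E.card : ℤ) - 1 := by
      intro E hE
      obtain ⟨v, hv, hne⟩ := hno E hE
      have : univ.filter (fun v => φ v = E) ⊂ E := by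
        refine Finset.ssubset_iff_subset_ne.2 ⟨fun w hw => ?_, fun h => ?_⟩
        · have := (mem_filter.1 hw).2
          rw [← this]
          exact hvφ w
        · rw [← h] at hv
          exact hne (mem_filter.1 hv).2
      have := card_lt_card this
      omega
    have h3 := sum_le_sum h2
    rw [card_univ, Fintype.card_fin] at h1
    rw [← Nat.cast_sum, ← h1] at h3
    omega
  refine ⟨E, hE, isOutermost_of_nearest hF hE fun v hv => ?_⟩
  have := hnear v
  rwa [hEφ v hv] at this

end

/-! ### The involution -/

open Classical in
/-- A choice of an outermost edge. -/
noncomputable def outermostEdge (T : Finset (Finset (Fin n))) : Finset (Fin n) :=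
  if h : ∃ E ∈ T, IsOutermost T E then h.choose else ∅

theorem outermostEdge_spec {T : Finset (Finset (Fin n))} (h : ∃ E ∈ T, IsOutermost T E) :
    outermostEdge T ∈ T ∧ IsOutermost T (outermostEdge T) := by
  rw [outermostEdge, dif_pos h]
  exact h.choose_spec

/-- Remove or add the chosen outermost edge of the completion. -/
noncomputable def toggle (F : Finset (Finset (Fin n))) : Finset (Finset (Fin n)) :=
  if outermostEdge (completion F) ∈ F then F.erase (outermostEdge (completion F))
  else insert (outermostEdge (completion F)) F

/-- `G` and `insert C G` have the same completion, hence the same chosen edge `C`, so `toggle`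
exchanges them. Both the cancellation of weights and the involution property are read off from such
a pair. -/
theorem toggle_cases (hn : 2 ≤ n) {F : Finset (Finset (Fin n))} (hF : IsForest F) :
    ∃ G C, IsForest G ∧ C ∈ dualClasses G ∧
      ((F = G ∧ toggle F = insert C G) ∨ (F = insert C G ∧ toggle F = G)) ∧
      toggle G = insert C G ∧ toggle (insert C G) = G := by
  obtain ⟨h1, h2⟩ := outermostEdge_spec (exists_isOutermost hn hF)
  set C := outermostEdge (completion F) with hC
  by_cases hCF : C ∈ F
  · have hd := mem_dualClasses_erase hF hCF h2
    have hins : insert C (F.erase C) = F := insert_erase hCF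
    have hcompl : completion (F.erase C) = completion F := by
      rw [← completion_insert hd, hins]
    have t1 : toggle F = F.erase C := by rw [toggle, ← hC, if_pos hCF]
    have t2 : toggle (F.erase C) = F := by
      rw [toggle, hcompl, ← hC, if_neg (notMem_erase C F), hins]
    exact ⟨F.erase C, C, hF.subset (erase_subset _ _), hd, Or.inr ⟨hins.symm, t1⟩,
      by rw [hins, t2], by rw [hins, t1]⟩
  · have hd : C ∈ dualClasses F := (mem_union.1 h1).resolve_left hCF
    have t1 : toggle F = insert C F := by rw [toggle, ← hC, if_neg hCF]
    have t2 : toggle (insert C F) = F := by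
      rw [toggle, completion_insert hd, ← hC, if_pos (mem_insert_self _ _), erase_insert hCF]
    exact ⟨F, C, hF, hd, Or.inl ⟨rfl, t1⟩, t1, t2⟩

section

variable {A : Type*} [CommRing A] (a : ℕ → A)

/-- The signed weight of a hypergraph. -/
def weight {α : Type*} (F : Finset (Finset α)) : A := (-1) ^ F.card * ∏ E ∈ F, a E.card

theorem weight_insert_mul_prod {F : Finset (Finset (Fin n))} {C : Finset (Fin n)}
    (hC : C ∈ dualClasses F) :
    weight a (insert C F) * ∏ D ∈ dualClasses (insert C F), a D.card =
      -(weight a F * ∏ D ∈ dualClasses F, a D.card) := by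
  have h := notMem_of_mem_dualClasses hC
  rw [weight, weight, card_insert_of_notMem h, prod_insert h, dualClasses_insert hC,
    ← mul_prod_erase _ _ hC]
  ring

open Classical in
/-- The weights of all noncrossing forests, multiplied by the weights of the dual classes, cancel. -/
theorem sum_forest (hn : 2 ≤ n) :
    ∑ F ∈ univ.filter fun F : Finset (Finset (Fin n)) => IsForest F,
      weight a F * ∏ D ∈ dualClasses F, a D.card = 0 := by
  refine sum_involution (fun F _ => toggle F) ?_ ?_ ?_ ?_
  · intro F hF
    obtain ⟨G, C, hG, hC, h | h, -⟩ := toggle_cases hn (mem_filter.1 hF).2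
    · rw [h.2, h.1, weight_insert_mul_prod a hC, add_neg_cancel]
    · rw [h.2, h.1, weight_insert_mul_prod a hC, neg_add_cancel]
  · intro F hF _
    obtain ⟨G, C, hG, hC, h | h, -⟩ := toggle_cases hn (mem_filter.1 hF).2
    · rw [h.2, h.1]
      exact (ne_insert_of_notMem _ _ (notMem_of_mem_dualClasses hC)).symm
    · rw [h.2, h.1]
      exact ne_insert_of_notMem _ _ (notMem_of_mem_dualClasses hC)
  · intro F hF
    rw [mem_filter]
    refine ⟨mem_univ _, ?_⟩
    obtain ⟨G, C, hG, hC, h | h, -⟩ := toggle_cases hn (mem_filter.1 hF).2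
    · rw [h.2]
      exact hG.insert hC
    · rw [h.2]
      exact hG
  · intro F hF
    obtain ⟨G, C, hG, hC, h | h, t1, t2⟩ := toggle_cases hn (mem_filter.1 hF).2
    · rw [h.2, t2, h.1]
    · rw [h.2, t1, h.1]

end

/-! ## Trees on the blocks of a partition -/

section

variable {m : ℕ}

/-- A noncrossing tree on a set of vertices. -/
def IsTreeOn (B : Finset (Fin n)) (F : Finset (Finset (Fin n))) : Prop :=
  IsForest F ∧ (∀ E ∈ F, E ⊆ B) ∧ ∀ x ∈ B, ∀ y ∈ B, comp F x y

theorem isTreeOn_univ {T : Finset (Finset (Fin n))} :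
    IsTreeOn univ T ↔ IsForest T ∧ comp T = ⊤ := by
  refine and_congr_right fun _ => ⟨fun h => eq_top_iff.2 fun x y _ => h.2 x (mem_univ x) y
    (mem_univ y), fun h => ⟨fun _ _ => subset_univ _, fun x _ y _ => ?_⟩⟩
  rw [h]
  trivial

/-- The embedding of hypergraphs given by an embedding of the vertices. -/
def mapEdges (e : Fin m ↪o Fin n) : Finset (Fin m) ↪ Finset (Fin n) :=
  ⟨Finset.map e.toEmbedding, map_injective _⟩

variable {e : Fin m ↪o Fin n} {T : Finset (Finset (Fin m))}

theorem mapEdges_apply (E : Finset (Fin m)) : mapEdges e E = E.map e.toEmbedding := rfl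

theorem comp_map {x y : Fin m} : comp (T.map (mapEdges e)) (e x) (e y) ↔ comp T x y := by
  constructor
  · intro h
    obtain ⟨z, hz, h⟩ := comp_ind h (fun w => ∃ z, e z = w ∧ comp T x z) (by
      intro E hE a ha b hb
      obtain ⟨E', hE', rfl⟩ := mem_map.1 hE
      obtain ⟨a', ha', rfl⟩ := mem_map.1 ha
      obtain ⟨b', hb', rfl⟩ := mem_map.1 hb
      rintro ⟨z, hz, h⟩
      obtain rfl := e.injective hz
      exact ⟨b', rfl, (comp T).trans' h (comp_of_mem hE' ha' hb')⟩) ⟨x, rfl, (comp T).refl' x⟩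
    rwa [← e.injective hz]
  · intro h
    refine comp_ind h (fun z => comp (T.map (mapEdges e)) (e x) (e z)) ?_ ((comp _).refl' _)
    intro E hE a ha b hb hxa
    exact (comp _).trans' hxa (comp_of_mem (mem_map_of_mem _ hE)
      (mem_map_of_mem e.toEmbedding ha) (mem_map_of_mem e.toEmbedding hb))

theorem isForest_map : IsForest (T.map (mapEdges e)) ↔ IsForest T := by
  refine and_congr ?_ (and_congr ?_ ?_)
  · simp [IsHypergraph, mapEdges_apply]
  · constructor
    · rintro h B hB C hC hne ⟨i, j, k, l, hij, hjk, hkl, hi, hk, hj, hl⟩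
      exact h _ (mem_map_of_mem _ hB) _ (mem_map_of_mem _ hC)
        (fun h => hne ((mapEdges e).injective h))
        ⟨e i, e j, e k, e l, e.lt_iff_lt.2 hij, e.lt_iff_lt.2 hjk, e.lt_iff_lt.2 hkl,
          mem_map_of_mem e.toEmbedding hi, mem_map_of_mem e.toEmbedding hk,
          mem_map_of_mem e.toEmbedding hj, mem_map_of_mem e.toEmbedding hl⟩
    · rintro h B hB C hC hne ⟨i, j, k, l, hij, hjk, hkl, hi, hk, hj, hl⟩
      obtain ⟨B', hB', rfl⟩ := mem_map.1 hB
      obtain ⟨C', hC', rfl⟩ := mem_map.1 hC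
      obtain ⟨i', hi', rfl⟩ := mem_map.1 hi
      obtain ⟨j', hj', rfl⟩ := mem_map.1 hj
      obtain ⟨k', hk', rfl⟩ := mem_map.1 hk
      obtain ⟨l', hl', rfl⟩ := mem_map.1 hl
      exact h B' hB' C' hC' (fun h => hne (by rw [h])) ⟨i', j', k', l', e.lt_iff_lt.1 hij,
        e.lt_iff_lt.1 hjk, e.lt_iff_lt.1 hkl, hi', hk', hj', hl'⟩
  · constructor
    · intro h E hE x hx y hy hxy
      refine e.injective (h _ (mem_map_of_mem _ hE) (e x) (mem_map_of_mem e.toEmbedding hx) (e y)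
        (mem_map_of_mem e.toEmbedding hy) ?_)
      rw [← map_erase, comp_map]
      exact hxy
    · intro h E hE x hx y hy hxy
      obtain ⟨E', hE', rfl⟩ := mem_map.1 hE
      obtain ⟨x', hx', rfl⟩ := mem_map.1 hx
      obtain ⟨y', hy', rfl⟩ := mem_map.1 hy
      rw [← map_erase] at hxy
      exact congrArg e (h E' hE' x' hx' y' hy' (comp_map.1 hxy))

theorem isTreeOn_map : IsTreeOn (univ.map e.toEmbedding) (T.map (mapEdges e)) ↔ IsTreeOn univ T := by
  refine and_congr isForest_map (and_congr ?_ ?_)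
  · simp only [mem_map, forall_exists_index, and_imp, forall_apply_eq_imp_iff₂, mapEdges_apply,
      map_subset_map]
  · simp only [mem_map, mem_univ, true_and, forall_exists_index, forall_apply_eq_imp_iff,
      RelEmbedding.coe_toEmbedding, comp_map, forall_const]

theorem exists_map_eq {F : Finset (Finset (Fin n))} (h : ∀ E ∈ F, E ⊆ univ.map e.toEmbedding) :
    ∃ T : Finset (Finset (Fin m)), T.map (mapEdges e) = F := by
  have : F ⊆ univ.map (mapEdges e) := by
    intro E hE
    obtain ⟨E', -, rfl⟩ := subset_map_iff.1 (h E hE)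
    exact mem_map_of_mem (mapEdges e) (mem_univ E')
  obtain ⟨T, -, hT⟩ := subset_map_iff.1 this
  exact ⟨T, hT.symm⟩

theorem exists_tree_of_isTreeOn {B : Finset (Fin n)} {F : Finset (Finset (Fin n))}
    (h : IsTreeOn B F) : ∃ T : Finset (Finset (Fin B.card)), IsTreeOn univ T ∧
      T.map (mapEdges (B.orderEmbOfFin rfl)) = F := by
  have hB := map_orderEmbOfFin_univ B rfl
  obtain ⟨T, hT⟩ := exists_map_eq (e := B.orderEmbOfFin rfl) (F := F) (by rw [hB]; exact h.2.1)
  refine ⟨T, (isTreeOn_map (e := B.orderEmbOfFin rfl)).1 ?_, hT⟩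
  rw [hT, hB]
  exact h

/-- The number of vertices of a tree whose edges have cardinality congruent to `1`. -/
theorem IsTreeOn.card_eq_one {d : ℕ} {B : Finset (Fin n)} {F : Finset (Finset (Fin n))}
    (h : IsTreeOn B F) (hB : B.Nonempty) (hF : ∀ E ∈ F, (E.card : ZMod d) = 1) :
    (B.card : ZMod d) = 1 := by
  obtain ⟨T, hT, rfl⟩ := exists_tree_of_isTreeOn h
  have : Nonempty (Fin B.card) := ⟨⟨0, card_pos.2 hB⟩⟩
  obtain ⟨hT, hc⟩ := isTreeOn_univ.1 hT
  have h1 := congrArg (Int.cast : ℤ → ZMod d) (hT.2.2.card_eq (IsHypergraph.nonempty hT.1))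
  rw [numComp_eq_one_iff.2 hc, Fintype.card_fin] at h1
  push_cast at h1
  rw [h1, sum_eq_zero, add_zero]
  intro E hE
  have := hF _ (mem_map_of_mem _ hE)
  rw [mapEdges_apply, card_map] at this
  rw [this, sub_self]

/-- A path that starts in `B` uses only edges that meet `B`, and by `h` these lie inside `B`. -/
theorem comp_restrict {B : Finset (Fin n)} {F : Finset (Finset (Fin n))}
    (h : ∀ E ∈ F, E ⊆ B ∨ Disjoint E B) {x y : Fin n} (hx : x ∈ B) (hxy : comp F x y) :
    y ∈ B ∧ comp (F.filter (· ⊆ B)) x y := by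
  refine comp_ind hxy (fun y => y ∈ B ∧ comp (F.filter (· ⊆ B)) x y) ?_ ⟨hx, (comp _).refl' x⟩
  rintro E hE a ha b hb ⟨haB, hxa⟩
  have hEB := (h E hE).resolve_right fun h => disjoint_left.1 h ha haB
  exact ⟨hEB hb, (comp _).trans' hxa (comp_of_mem (mem_filter.2 ⟨hE, hEB⟩) ha hb)⟩

/-! ### Products over the blocks -/

variable {A : Type*} [CommRing A] (a : ℕ → A)

open Classical in
/-- The sum of the weights of all noncrossing trees on `m` points. -/
noncomputable def treeSum (m : ℕ) : A :=
  ∑ T ∈ univ.filter fun T : Finset (Finset (Fin m)) => IsTreeOn univ T, weight a T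

theorem weight_map : weight a (T.map (mapEdges e)) = weight a T := by
  simp [weight, mapEdges_apply]

open Classical in
theorem sum_isTreeOn (B : Finset (Fin n)) :
    ∑ F ∈ univ.filter fun F => IsTreeOn B F, weight a F = treeSum a B.card := by
  symm
  refine sum_bij (fun T _ => T.map (mapEdges (B.orderEmbOfFin rfl))) ?_ ?_ ?_ ?_
  · intro T hT
    simp only [mem_filter, mem_univ, true_and] at hT ⊢
    rw [← isTreeOn_map (e := B.orderEmbOfFin rfl), map_orderEmbOfFin_univ] at hT
    exact hT
  · intro T _ T' _ h
    exact map_injective _ h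
  · intro F hF
    obtain ⟨T, hT, h⟩ := exists_tree_of_isTreeOn (mem_filter.1 hF).2
    exact ⟨T, mem_filter.2 ⟨mem_univ _, hT⟩, h⟩
  · intro T _
    rw [weight_map]

variable {π : Finpartition (univ : Finset (Fin n))}

theorem subset_or_disjoint_of_mem_parts {B C E : Finset (Fin n)} (hB : B ∈ π.parts)
    (hC : C ∈ π.parts) (hE : E ⊆ C) : E ⊆ B ∨ Disjoint E B := by
  by_cases h : C = B
  · exact Or.inl (h ▸ hE)
  · exact Or.inr ((π.disjoint hC hB h).mono_left hE)

theorem eq_of_edge_subset {B C E : Finset (Fin n)} (hB : B ∈ π.parts)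
    (hC : C ∈ π.parts) (hE : 2 ≤ E.card) (hEB : E ⊆ B) (hEC : E ⊆ C) : B = C := by
  obtain ⟨x, hx⟩ := card_pos.1 (by omega : 0 < E.card)
  exact π.eq_of_mem_parts hB hC (hEB hx) (hEC hx)

/-- The union of noncrossing trees on the blocks of a noncrossing partition. -/
theorem isForest_union (hπ : IsNoncr (rel π)) {p : ∀ B ∈ π.parts, Finset (Finset (Fin n))}
    (hp : ∀ B hB, IsTreeOn B (p B hB)) {U : Finset (Finset (Fin n))}
    (hU : ∀ E, E ∈ U ↔ ∃ B, ∃ hB : B ∈ π.parts, E ∈ p B hB) :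
    IsForest U ∧ comp U = rel π := by
  refine ⟨⟨?_, ?_, ?_⟩, le_antisymm (comp_le fun E hE x hx y hy => ?_) fun x y hxy => ?_⟩
  · intro E hE
    obtain ⟨B, hB, hE⟩ := (hU E).1 hE
    exact (hp B hB).1.1 E hE
  · rintro E hE G hG hne
    obtain ⟨B, hB, hE⟩ := (hU E).1 hE
    obtain ⟨C, hC, hG⟩ := (hU G).1 hG
    by_cases hBC : B = C
    · subst hBC
      exact (hp B hB).1.2.1 E hE G hG hne
    · rintro ⟨i, j, k, l, hij, hjk, hkl, hi, hk, hj, hl⟩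
      have hiB := (hp B hB).2.1 E hE hi
      have hjC := (hp C hC).2.1 G hG hj
      have := hπ i j k l hij hjk hkl ((rel_of_mem hB hiB).2 ((hp B hB).2.1 E hE hk))
        ((rel_of_mem hC hjC).2 ((hp C hC).2.1 G hG hl))
      exact hBC (π.eq_of_mem_parts hB hC ((rel_of_mem hB hiB).1 this) hjC)
  · intro E hEU x hx y hy hxy
    obtain ⟨B, hB, hE⟩ := (hU E).1 hEU
    refine (hp B hB).1.2.2 E hE x hx y hy (comp_mono ?_ (comp_restrict (B := B) ?_
      ((hp B hB).2.1 E hE hx) hxy).2)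
    · intro G hG
      obtain ⟨hG, hGB⟩ := mem_filter.1 hG
      obtain ⟨hGE, hG⟩ := mem_erase.1 hG
      obtain ⟨C, hC, hG⟩ := (hU G).1 hG
      obtain rfl := eq_of_edge_subset hB hC ((hp C hC).1.1 G hG) hGB ((hp C hC).2.1 G hG)
      exact mem_erase.2 ⟨hGE, hG⟩
    · intro G hG
      obtain ⟨C, hC, hG⟩ := (hU G).1 (mem_of_mem_erase hG)
      exact subset_or_disjoint_of_mem_parts hB hC ((hp C hC).2.1 G hG)
  · obtain ⟨B, hB, hE⟩ := (hU E).1 hE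
    exact (rel_of_mem hB ((hp B hB).2.1 E hE hx)).2 ((hp B hB).2.1 E hE hy)
  · obtain ⟨B, hB, hx, hy⟩ := rel_iff.1 hxy
    exact comp_mono (fun E hE => (hU E).2 ⟨B, hB, hE⟩) ((hp B hB).2.2 x hx y hy)

/-- A forest splits into trees on its components. -/
theorem isTreeOn_filter {F : Finset (Finset (Fin n))} (hF : IsForest F) (hc : comp F = rel π)
    {B : Finset (Fin n)} (hB : B ∈ π.parts) : IsTreeOn B (F.filter (· ⊆ B)) := by
  refine ⟨hF.subset (filter_subset _ _), fun E hE => (mem_filter.1 hE).2, fun x hx y hy => ?_⟩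
  refine (comp_restrict ?_ hx ?_).2
  · intro E hE
    obtain ⟨z, hz⟩ := IsHypergraph.nonempty hF.1 E hE
    refine subset_or_disjoint_of_mem_parts hB (part_mem_parts π z) fun w hw => ?_
    rw [← rel_iff_mem, ← hc]
    exact comp_of_mem hE hz hw
  · rw [hc]
    exact (rel_of_mem hB hx).2 hy

theorem exists_part_of_edge {F : Finset (Finset (Fin n))} (hF : IsForest F) (hc : comp F = rel π)
    {E : Finset (Fin n)} (hE : E ∈ F) : ∃ B ∈ π.parts, E ⊆ B := by
  obtain ⟨z, hz⟩ := IsHypergraph.nonempty hF.1 E hE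
  refine ⟨π.part z, part_mem_parts π z, fun w hw => ?_⟩
  rw [← rel_iff_mem, ← hc]
  exact comp_of_mem hE hz hw

-- Expanding the product chooses a tree on each block. The union of the trees is a forest with
-- components `π`, and the trees are recovered as the edges inside each block; edges have at least
-- two elements, so each lies in one block only.
open Classical in
theorem prod_treeSum (hπ : IsNoncr (rel π)) :
    ∏ B ∈ π.parts, treeSum a B.card =
      ∑ F ∈ univ.filter fun F => IsForest F ∧ comp F = rel π, weight a F := by
  simp only [← sum_isTreeOn]
  rw [prod_sum]
  have hspec : ∀ p ∈ π.parts.pi (fun B => univ.filter fun F => IsTreeOn B F),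
      ∀ B hB, IsTreeOn B (p B hB) := fun p hp B hB => (mem_filter.1 (mem_pi.1 hp B hB)).2
  have hmem : ∀ (p : ∀ B ∈ π.parts, Finset (Finset (Fin n))) E,
      E ∈ π.parts.attach.biUnion (fun B => p B.1 B.2) ↔ ∃ B, ∃ hB : B ∈ π.parts, E ∈ p B hB := by
    intro p E
    simp
  refine sum_bij' (fun p _ => π.parts.attach.biUnion fun B => p B.1 B.2)
    (fun F _ B _ => F.filter (· ⊆ B)) ?_ ?_ ?_ ?_ ?_
  · intro p hp
    exact mem_filter.2 ⟨mem_univ _, isForest_union hπ (hspec p hp) (hmem p)⟩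
  · intro F hF
    obtain ⟨-, hF, hc⟩ := mem_filter.1 hF
    exact mem_pi.2 fun B hB => mem_filter.2 ⟨mem_univ _, isTreeOn_filter hF hc hB⟩
  · intro p hp
    funext B hB
    ext E
    rw [mem_filter, hmem]
    constructor
    · rintro ⟨⟨C, hC, hE⟩, hEB⟩
      have := hspec p hp C hC
      obtain rfl := eq_of_edge_subset hB hC (this.1.1 E hE) hEB (this.2.1 E hE)
      exact hE
    · intro hE
      exact ⟨⟨B, hB, hE⟩, (hspec p hp B hB).2.1 E hE⟩
  · intro F hF
    obtain ⟨-, hF, hc⟩ := mem_filter.1 hF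
    ext E
    refine (hmem (fun B _ => F.filter (· ⊆ B)) E).trans ?_
    constructor
    · rintro ⟨B, hB, hE⟩
      exact (mem_filter.1 hE).1
    · intro hE
      obtain ⟨B, hB, hEB⟩ := exists_part_of_edge hF hc hE
      exact ⟨B, hB, mem_filter.2 ⟨hE, hEB⟩⟩
  · intro p hp
    have hdisj : (π.parts.attach : Set π.parts).PairwiseDisjoint fun B => p B.1 B.2 := by
      intro B _ C _ hne
      refine disjoint_left.2 fun E hE hE' => hne (Subtype.ext ?_)
      have h1 := hspec p hp B.1 B.2
      exact eq_of_edge_subset B.2 C.2 (h1.1.1 E hE) (h1.2.1 E hE)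
        ((hspec p hp C.1 C.2).2.1 E hE')
    simp only [weight]
    rw [card_biUnion hdisj, prod_biUnion hdisj, prod_mul_distrib, prod_pow_eq_pow_sum]

variable {a}

/-- Blocks with one element do not contribute to the product over the dual. -/
theorem prod_dualClasses (ha : a 1 = 1) {F : Finset (Finset (Fin n))} (hc : comp F = rel π) :
    ∏ D ∈ dualClasses F, a D.card = ∏ C ∈ (krewerasDual π).parts, a C.card := by
  have hcl : ∀ C ∈ (krewerasDual π).parts, ∀ x ∈ C, ∀ y, kr (comp F) x y ↔ y ∈ C := by
    intro C hC x hx y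
    rw [hc, ← rel_krewerasDual, rel_of_mem hC hx]
  refine prod_subset (fun D hD => ?_) fun C hC hC' => ?_
  · obtain ⟨h2, hD⟩ := mem_dualClasses.1 hD
    obtain ⟨x, hx⟩ := card_pos.1 (by omega : 0 < D.card)
    have hp := part_mem_parts (krewerasDual π) x
    have : D = (krewerasDual π).part x := by
      ext y
      rw [← hD x hx, hcl _ hp x (mem_part _ x)]
    rw [this]
    exact hp
  · have h1 : 0 < C.card := card_pos.2 ((krewerasDual π).nonempty_of_mem_parts hC)
    have h2 : ¬ 2 ≤ C.card := fun h2 => hC' (mem_dualClasses.2 ⟨h2, hcl C hC⟩)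
    rw [show C.card = 1 by omega, ha]

/-- A forest whose weight is not zero has an indivisible noncrossing partition of components. -/
theorem exists_nc_of_weight_ne_zero {d : ℕ} (ha : a 1 = 1) (had : ∀ m, ¬ m ≡ 1 [MOD d] → a m = 0)
    {F : Finset (Finset (Fin n))} (hF : IsForest F)
    (h : weight a F * ∏ D ∈ dualClasses F, a D.card ≠ 0) : ∃ π : NC d n, comp F = rel π.1 := by
  classical
  let π := Finpartition.ofSetoid (comp F)
  have hc : comp F = rel π := (rel_ofSetoid _).symm
  have h1 : ∀ E ∈ F, E.card ≡ 1 [MOD d] := fun E hE => by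
    by_contra hcard
    refine h ?_
    rw [weight, prod_eq_zero hE (had _ hcard), mul_zero, zero_mul]
  refine ⟨⟨π, isNoncr_rel.1 (hc ▸ isNoncr_comp hF.2.1), fun B hB => ?_, fun C hC => ?_⟩, hc⟩
  · rw [← ZMod.natCast_eq_natCast_iff, Nat.cast_one]
    exact (isTreeOn_filter hF hc hB).card_eq_one (π.nonempty_of_mem_parts hB)
      fun E hE => cast_eq_one (h1 E (mem_filter.1 hE).1)
  · by_contra hcard
    refine h ?_
    rw [prod_dualClasses ha hc, prod_eq_zero hC (had _ hcard), mul_zero]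

/-- The recursion of the antipode holds for the sums over noncrossing trees. -/
theorem sum_prod_treeSum {d : ℕ} [Fintype (NC d n)] (hn : 2 ≤ n) (ha : a 1 = 1)
    (had : ∀ m, ¬ m ≡ 1 [MOD d] → a m = 0) :
    ∑ π : NC d n, (∏ B ∈ π.1.parts, treeSum a B.card) *
      ∏ C ∈ (krewerasDual π.1).parts, a C.card = 0 := by
  classical
  rw [← sum_forest a hn]
  have h1 : ∀ π : NC d n, (∏ B ∈ π.1.parts, treeSum a B.card) *
      ∏ C ∈ (krewerasDual π.1).parts, a C.card =
      ∑ F ∈ univ.filter fun F : Finset (Finset (Fin n)) => IsForest F,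
        if comp F = rel π.1 then weight a F * ∏ D ∈ dualClasses F, a D.card else 0 := by
    intro π
    rw [prod_treeSum a (isNoncr_rel.2 π.2.1), sum_mul, ← sum_filter, filter_filter]
    refine sum_congr rfl fun F hF => ?_
    rw [prod_dualClasses ha (mem_filter.1 hF).2.2]
  rw [sum_congr rfl fun π _ => h1 π, sum_comm]
  refine sum_congr rfl fun F hF => ?_
  -- A forest has one component partition, so it is counted once if that partition is in `NC d n`;
  -- otherwise its total weight is zero.
  by_cases hex : ∃ π : NC d n, comp F = rel π.1
  · obtain ⟨π, hπ⟩ := hex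
    rw [sum_eq_single π, if_pos hπ]
    · intro σ _ hne
      rw [if_neg]
      exact fun h => hne (Subtype.ext (parts_eq_of_rel_eq (h.symm.trans hπ)))
    · exact fun h => absurd (mem_univ _) h
  · rw [sum_eq_zero]
    · by_contra h
      exact hex (exists_nc_of_weight_ne_zero ha had (mem_filter.1 hF).2 (Ne.symm h))
    · intro π _
      rw [if_neg fun h => hex ⟨π, h⟩]

theorem treeSum_one : treeSum a 1 = 1 := by
  classical
  have : (univ.filter fun T : Finset (Finset (Fin 1)) => IsTreeOn univ T) = {∅} := by
    ext T
    simp only [mem_filter, mem_univ, true_and, mem_singleton]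
    constructor
    · intro h
      refine eq_empty_of_forall_notMem fun E hE => ?_
      have h1 := h.1.1 E hE
      have h2 := card_le_univ E
      rw [Fintype.card_fin] at h2
      omega
    · rintro rfl
      refine ⟨⟨?_, ?_, ?_⟩, ?_, fun x _ y _ => ?_⟩
      · intro E hE; simp at hE
      · intro E hE; simp at hE
      · intro E hE; simp at hE
      · intro E hE; simp at hE
      · rw [Subsingleton.elim x y]
  rw [treeSum, this, sum_singleton]
  simp [weight]

end

/-! ## The antipode -/

section

variable (R : Type*) [CommRing R]

open Classical in
/-- The poset of indivisible noncrossing partitions in the Hopf algebra, and zero if the number of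
points is not congruent to `1`. -/
noncomputable def ncOrZero (d m : ℕ) : PosetHopf R :=
  if h : m ≡ 1 [MOD d] then NC.toHopf R d m h else 0

theorem ncOrZero_of (h : n ≡ 1 [MOD d]) : ncOrZero R d n = NC.toHopf R d n h := dif_pos h

theorem toHopf_one (h : 1 ≡ 1 [MOD d]) : NC.toHopf R d 1 h = 1 := by
  let _ := NC.boundedOrder h
  have : Subsingleton (NC d 1) := ⟨fun π σ => Subtype.ext (parts_eq_of_rel_eq (by
    ext x y
    rw [Subsingleton.elim x y]
    exact iff_of_true ((rel π.1).refl' y) ((rel σ.1).refl' y)))⟩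
  exact PosetHopf.of_eq_one _

theorem not_subsingleton_nc (hn : 2 ≤ n) (h : n ≡ 1 [MOD d]) : ¬ Subsingleton (NC d n) := by
  intro hs
  let _ := NC.boundedOrder h
  have h1 : (⊥ : NC d n).1 = (⊤ : NC d n).1 := congrArg Subtype.val (hs.elim (⊥ : NC d n) ⊤)
  have h2 : (⊥ : Finpartition (univ : Finset (Fin n))) = ⊤ := h1
  have h3 : (⊤ : Finpartition (univ : Finset (Fin n))).parts ⊆ {univ} :=
    Finpartition.parts_top_subset _
  rw [← h2] at h3
  have h4 := mem_singleton.1 (h3 (Finpartition.mem_bot_iff.2 ⟨⟨0, by omega⟩, mem_univ _, rfl⟩))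
  have h5 := congrArg card h4
  rw [card_singleton, card_univ, Fintype.card_fin] at h5
  omega

/-- `treeSum` runs over all noncrossing trees, but `ncOrZero` gives weight zero to those with an
edge of the wrong size. -/
theorem treeSum_eq (hn : 0 < n) :
    treeSum (ncOrZero R d) n = ∑ T : NCHypertree d n, (-1 : PosetHopf R) ^ T.edges.card *
      ∏ E : T.edges, NC.toHopf R d E.1.card (T.card_edge E) := by
  classical
  have h1 : ∀ T : NCHypertree d n, (-1 : PosetHopf R) ^ T.edges.card *
      ∏ E : T.edges, NC.toHopf R d E.1.card (T.card_edge E) = weight (ncOrZero R d) T.1 := by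
    intro T
    rw [weight]
    congr 1
    exact (prod_congr rfl fun E _ => (ncOrZero_of R (T.card_edge E)).symm).trans
      (prod_coe_sort T.1 fun E => ncOrZero R d E.card)
  rw [sum_congr rfl fun T _ => h1 T, treeSum]
  symm
  refine sum_bij_ne_zero (fun T _ _ => T.1) ?_ ?_ ?_ ?_
  · intro T _ _
    obtain ⟨h2, h3, h4⟩ := (isHypertree_iff hn).1 T.2.1
    exact mem_filter.2 ⟨mem_univ _, isTreeOn_univ.2 ⟨⟨h2, T.2.2.1, h4⟩, h3⟩⟩
  · intro T _ _ T' _ _ h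
    exact Subtype.ext h
  · intro T hT hne
    obtain ⟨⟨h2, h3, h4⟩, h5⟩ := isTreeOn_univ.1 (mem_filter.1 hT).2
    have h6 : ∀ E ∈ T, E.card ≡ 1 [MOD d] := fun E hE => by
      by_contra hcard
      refine hne ?_
      rw [weight, prod_eq_zero hE (dif_neg hcard), mul_zero]
    exact ⟨⟨T, (isHypertree_iff hn).2 ⟨h2, h5, h4⟩, h3, h6⟩, mem_univ _, hne, rfl⟩
  · intro T _ _
    rfl

open Classical in
/-- The antipode of `ncOrZero`. -/
theorem sum_prod_antipode [Fintype (NC d n)] (hn : 2 ≤ n) (h : n ≡ 1 [MOD d]) :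
    ∑ π : NC d n, (∏ B ∈ π.1.parts, HopfAlgebra.antipode R (ncOrZero R d B.card)) *
      ∏ C ∈ (krewerasDual π.1).parts, ncOrZero R d C.card = 0 := by
  let _ := NC.boundedOrder h
  have key := HopfAlgebra.mul_antipode_rTensor_comul_apply (R := R) (PosetHopf.of R (NC d n))
  rw [PosetHopf.comul_of, PosetHopf.counit_of, if_neg (not_subsingleton_nc hn h), map_zero] at key
  simp only [map_sum, LinearMap.rTensor_tmul, LinearMap.mul'_apply] at key
  rw [← key]
  refine sum_congr rfl fun π _ => ?_
  rw [of_Iic R h π, of_Ici R h π]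
  congr 1
  · rw [← prod_coe_sort]
    -- The Hopf algebra is commutative, so its antipode is multiplicative.
    change _ = HopfAlgebra.antipodeAlgHom R (PosetHopf R) _
    rw [map_prod]
    exact prod_congr rfl fun B _ => congrArg (HopfAlgebra.antipode R)
      (ncOrZero_of R (π.2.2.1 B.1 B.2))
  · rw [← prod_coe_sort]
    exact prod_congr rfl fun C _ => ncOrZero_of R (π.2.2.2 C.1 C.2)

/-- Both sides satisfy the same recursion, and every `π ≠ ⊤` has only blocks with fewer than `n`
elements, so the two recursions agree in all terms but that of `⊤`. -/
theorem antipode_toHopf (hn : 0 < n) (h : n ≡ 1 [MOD d]) :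
    HopfAlgebra.antipode R (NC.toHopf R d n h) = treeSum (ncOrZero R d) n := by
  classical
  induction n using Nat.strong_induction_on with | _ n ih
  rcases eq_or_lt_of_le (show 1 ≤ n from hn) with rfl | hn2
  · rw [toHopf_one, treeSum_one, HopfAlgebra.antipode_one]
  let _ := NC.boundedOrder h
  let _ := Fintype.ofFinite (NC d n)
  have h1 : ncOrZero R d 1 = 1 := (ncOrZero_of R rfl).trans (toHopf_one R rfl)
  have e1 := sum_prod_antipode R hn2 h
  have e2 := sum_prod_treeSum (n := n) (a := ncOrZero R d) hn2 h1 fun m hm => dif_neg hm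
  rw [← add_sum_erase _ _ (mem_univ (⊤ : NC d n))] at e1 e2
  have e3 : ∀ π ∈ univ.erase (⊤ : NC d n),
      (∏ B ∈ π.1.parts, HopfAlgebra.antipode R (ncOrZero R d B.card)) *
        ∏ C ∈ (krewerasDual π.1).parts, ncOrZero R d C.card =
      (∏ B ∈ π.1.parts, treeSum (ncOrZero R d) B.card) *
        ∏ C ∈ (krewerasDual π.1).parts, ncOrZero R d C.card := by
    intro π hπ
    congr 1
    refine prod_congr rfl fun B hB => ?_
    have hB0 := card_pos.2 (π.1.nonempty_of_mem_parts hB)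
    have hBn : B.card < n := by
      have hle := card_le_univ B
      rw [Fintype.card_fin] at hle
      refine lt_of_le_of_ne hle fun heq => (mem_erase.1 hπ).1 (top_le_iff.1 ?_)
      have hBu : B = univ := (card_eq_iff_eq_univ B).1 (by rw [heq, Fintype.card_fin])
      exact fun C _ => ⟨B, hB, by rw [hBu]; exact subset_univ C⟩
    rw [ncOrZero_of R (π.2.2.1 B hB)]
    exact ih B.card hBn hB0 _
  rw [sum_congr rfl e3] at e1
  have e4 := add_right_cancel (e1.trans e2.symm)
  have hparts : (⊤ : NC d n).1.parts = {univ} := by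
    have hsub : (⊤ : NC d n).1.parts ⊆ {univ} := Finpartition.parts_top_subset _
    refine (subset_singleton_iff.1 hsub).resolve_left fun hemp => ?_
    have := part_mem_parts (⊤ : NC d n).1 ⟨0, hn⟩
    rw [hemp] at this
    exact notMem_empty _ this
  -- This product represents the upper interval of `⊤`, which has one point.
  have hdual : ∏ C ∈ (krewerasDual (⊤ : NC d n).1).parts, ncOrZero R d C.card = 1 := by
    have h2 := of_Ici R h (⊤ : NC d n)
    have : Subsingleton (Set.Ici (⊤ : NC d n)) := (PosetHopf.subsingleton_Ici_iff _).2 rfl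
    rw [PosetHopf.of_eq_one] at h2
    rw [h2, ← prod_coe_sort]
    exact prod_congr rfl fun C _ => ncOrZero_of R ((⊤ : NC d n).2.2.2 C.1 C.2)
  rw [hdual, mul_one, mul_one, hparts, prod_singleton, prod_singleton, card_univ,
    Fintype.card_fin, ncOrZero_of R h] at e4
  exact e4

end

end Noncrossing

theorem mainTheorem3 (R : Type*) [CommRing R] (n d : ℕ) (hn : 0 < n) (hd : 0 < d)
    (h : n ≡ 1 [MOD d]) :
    HopfAlgebra.antipode R (NC.toHopf R d n h) =
      ∑ T : NCHypertree d n, (-1 : PosetHopf R) ^ T.edges.card *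
        ∏ E : T.edges, NC.toHopf R d E.1.card (T.card_edge E) :=
  (Noncrossing.antipode_toHopf R hn h).trans (Noncrossing.treeSum_eq R hn)
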